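/- Let $X=F_1\oplus F_2\oplus F_3\oplus F_4$ be a direct sum of (real or complex) Banach spaces of cotype $r$, for some $r<\infty$, and suppose that each $F_i$ has a normalized 1-unconditional Schauder basis $\{f_{i,l}\}_{l\ge 1}$, i.e. $\|f_{i,l}\|=1$ and $\|\sum_l \varepsilon_l t_l f_{i,l}\|\le\|\sum_l t_l f_{i,l}\|$ for every convergent series $\sum_l t_l f_{i,l}$ and all signs $\varepsilon_l=\pm1$. Assume that for $i=1,2,3$: (a) the basis $\{f_{i,l}\}_l$ dominates $\{f_{i+1,l}\}_l$, i.e. the formal identity $\sum_l t_l f_{i,l}\mapsto\sum_l t_l f_{i+1,l}$ is a bounded operator from $F_i$ to $F_{i+1}$; (b) for no $l_1<l_2<\cdots$ are the subsequences $\{f_{i,l_j}\}_j$ and $\{f_{i+1,l_j}\}_j$ equivalent, i.e. the formal identities between their closed linear spans are never bounded in both directions. Then there is a closed subspace $Y$ of $X$ that does not have local unconditional structure but has an unconditional Schauder decomposition $\{Z_k\}_{k\ge1}$ with $\dim Z_k=2$ for all $k$. Here $Y$ has local unconditional structure if there is $C\ge1$ such that for every finite-dimensional subspace $X_0\subset Y$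 there are a Banach space $F$ with a (finite or infinite) 1-unconditional basis and bounded linear operators $u_0:X_0\to F$, $w_0:F\to Y$ with $w_0u_0x=x$ for all $x\in X_0$ and $\|u_0\|\,\|w_0\|\le C$. A Schauder decomposition $\{Z_k\}$ of $Y$ is a sequence of closed subspaces such that every $y\in Y$ has a unique expansion $y=\sum_k z_k$ with $z_k\in Z_k$; it is unconditional if there is $C$ with $\|\sum_k\varepsilon_k z_k\|\le C\|\sum_k z_k\|$ for all finite sequences $z_k\in Z_k$ and all signs $\varepsilon_k=\pm1$. -/

import Mathlib

open Filter Topology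

/-- A basis `{e_j}` is `1`-unconditional if for every `x = ∑ t_j e_j` and every choice of signs
`ε_j = ± 1` the series `∑ ε_j t_j e_j` converges and has norm at most `‖x‖`. -/
def IsOneUnconditional {β 𝕜 E : Type*} [NontriviallyNormedField 𝕜] [NormedAddCommGroup E]
    [NormedSpace 𝕜 E] {L : SummationFilter β} (e : GeneralSchauderBasis β 𝕜 E L) : Prop :=
  ∀ (x : E) (ε : β → ℤˣ), ∃ y : E, HasSum (fun j => ε j • (e.coord j x • e j)) y L ∧ ‖y‖ ≤ ‖x‖

/-- `E` has cotype `r`: the `ℓ_r`-sum of the norms of finitely many vectors is at most a constant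
times the average of `‖∑ ± x_i‖` over all choices of signs. -/
def HasCotype (E : Type*) [NormedAddCommGroup E] (r : ℝ) : Prop :=
  ∃ C : ℝ, ∀ (n : ℕ) (x : Fin n → E),
    (∑ i, ‖x i‖ ^ r) ^ (1 / r) ≤ C * ((∑ ε : Fin n → ℤˣ, ‖∑ i, ε i • x i‖) / 2 ^ n)

/-- The sequence `x` dominates the sequence `y`: the formal identity `∑ t_l x_l ↦ ∑ t_l y_l` is
bounded. (Boundedness is expressed on finite sums, which are dense in the closed span of `x`.) -/
def Dominates (𝕜 : Type*) {E E' : Type*} [NormedField 𝕜] [NormedAddCommGroup E] [NormedSpace 𝕜 E]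
    [NormedAddCommGroup E'] [NormedSpace 𝕜 E'] (x : ℕ → E) (y : ℕ → E') : Prop :=
  ∃ C : ℝ, ∀ (s : Finset ℕ) (t : ℕ → 𝕜), ‖∑ l ∈ s, t l • y l‖ ≤ C * ‖∑ l ∈ s, t l • x l‖

/-- The sequences `x` and `y` are equivalent: the formal identity is bounded both ways. -/
def SeqEquivalent (𝕜 : Type*) {E E' : Type*} [NormedField 𝕜] [NormedAddCommGroup E]
    [NormedSpace 𝕜 E] [NormedAddCommGroup E'] [NormedSpace 𝕜 E'] (x : ℕ → E) (y : ℕ → E') : Prop :=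
  Dominates 𝕜 x y ∧ Dominates 𝕜 y x

/-- `E` has local unconditional structure: with one constant `C`, the embedding into `E` of every
finite-dimensional subspace factors through a Banach space `F` with a (finite or infinite)
`1`-unconditional basis. A space with a countable basis is separable, hence has an isometric copy
in `Type`; so letting `F` range over `Type` loses nothing. -/
def HasLocalUnconditionalStructure (𝕜 E : Type*) [RCLike 𝕜] [NormedAddCommGroup E]
    [NormedSpace 𝕜 E] : Prop :=
  ∃ C : ℝ, 1 ≤ C ∧ ∀ X₀ : Submodule 𝕜 E, FiniteDimensional 𝕜 X₀ →
    ∃ (F : Type) (_ : NormedAddCommGroup F) (_ : NormedSpace 𝕜 F) (_ : CompleteSpace F)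
      (ι : Type) (_ : Countable ι) (e : UnconditionalSchauderBasis ι 𝕜 F)
      (u₀ : X₀ →L[𝕜] F) (w₀ : F →L[𝕜] E),
      IsOneUnconditional e ∧ w₀.comp u₀ = X₀.subtypeL ∧ ‖u₀‖ * ‖w₀‖ ≤ C

/-- `{Z_k}` is a Schauder decomposition of `E`: the `Z_k` are closed subspaces and every `x` has a
unique expansion `x = ∑ z_k` with `z_k ∈ Z_k` (norm convergence of the partial sums). -/
def IsSchauderDecomposition {𝕜 E : Type*} [RCLike 𝕜] [NormedAddCommGroup E] [NormedSpace 𝕜 E]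
    (Z : ℕ → Submodule 𝕜 E) : Prop :=
  (∀ k, IsClosed (Z k : Set E)) ∧
    ∀ x : E, ∃! z : (k : ℕ) → Z k,
      Tendsto (fun n => ∑ k ∈ Finset.range n, (z k : E)) atTop (𝓝 x)

/-- `{Z_k}` is an unconditional (Schauder) decomposition of `E`. -/
def IsUnconditionalDecomposition {𝕜 E : Type*} [RCLike 𝕜] [NormedAddCommGroup E]
    [NormedSpace 𝕜 E] (Z : ℕ → Submodule 𝕜 E) : Prop :=
  IsSchauderDecomposition Z ∧
    ∃ C : ℝ, ∀ (s : Finset ℕ) (z : (k : ℕ) → Z k) (ε : ℕ → ℤˣ),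
      ‖∑ k ∈ s, ε k • (z k : E)‖ ≤ C * ‖∑ k ∈ s, (z k : E)‖

/-! The subspace is the span of planes: the `k`-th plane consists of the vectors with components `w
i k * φ i p • f i k`, where `p` runs over `𝕜 × 𝕜` and the functionals `φ i` are `x`, `y`, `x - y`,
`x`. Sign changes of whole planes act on each component as sign changes of a basis, so the planes
form an unconditional decomposition for any positive weights.

Suppose that finitely many planes factor through a space with a 1-unconditional basis `e`. On each
plane the identity, of trace 2, becomes a sum of rank one operators indexed by `e`. A rank one
operator preserving the kernels of `x`, `y` and `x - y` would have these three distinct lines as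
eigenlines, hence would be scalar, hence zero. Quantitatively (`norm_add_le_of_rank_one`), suitable
signs on `e` move the kernel vector of one of the three functionals away from that kernel by a fixed
amount; the index of this functional is the color of `k`. The signs vary with `k`, so they do not
come from a single sign change of `e`. Finite cotype still allows them: with Maurey's square
function estimate, `CotypeBound.norm_sum_diagonal_le` bounds the resulting diagonal operator,
because a square function does not see signs. Thus on color `i` the weighted basis `f i` is
controlled by the other components of the kernel vectors. A compactness argument makes the coloring
global.

The weights rule out every coloring. The integers contain blocks, indexed by pairs `(m, p)`, on
which `f 0` is far larger than `f 1`, so late blocks are not entirely of color 0. Choose in each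
late block an integer of another color. Either some `m` admits infinitely many of color 1, along
which `f 1` and `f 2` are equivalent, or every `m` admits one of color 2, and along these `f 2` and
`f 3` are equivalent. Both are excluded. -/

section Signs

/-! ### Multipliers and sign changes -/

variable {𝕜 E ι : Type*} [RCLike 𝕜] [NormedAddCommGroup E] [NormedSpace 𝕜 E]

theorem units_smul_eq_smul (𝕜 : Type*) {E : Type*} [RCLike 𝕜] [NormedAddCommGroup E]
    [NormedSpace 𝕜 E] (u : ℤˣ) (x : E) : u • x = (((u : ℤ) : 𝕜)) • x := by
  rcases Int.units_eq_one_or u with rfl | rfl <;> simp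

theorem norm_units_cast (u : ℤˣ) : ‖((u : ℤ) : 𝕜)‖ = 1 := by
  rcases Int.units_eq_one_or u with rfl | rfl <;> simp

/-- A point of the cube is a convex combination of its vertices, taken one coordinate at a time. The
free vector `z` absorbs the coordinate whose sign is already fixed in the induction. -/
theorem norm_add_sum_real_smul_le (J : Finset ι) (x : ι → E) (W : ℝ) (c : ι → ℝ)
    (hc : ∀ j ∈ J, |c j| ≤ 1) (z : E)
    (h : ∀ ε : ι → ℤˣ, ‖z + ∑ j ∈ J, ε j • x j‖ ≤ W) :
    ‖z + ∑ j ∈ J, (c j : 𝕜) • x j‖ ≤ W := by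
  classical
  induction J using Finset.induction_on generalizing z with
  | empty => simpa using h 1
  | insert a J ha ih =>
    have key : ∀ η : ℤˣ, ‖(z + η • x a) + ∑ j ∈ J, (c j : 𝕜) • x j‖ ≤ W := by
      intro η
      refine ih (fun j hj => hc j (Finset.mem_insert_of_mem hj)) _ fun ε => ?_
      have := h (Function.update ε a η)
      rw [Finset.sum_insert ha, Function.update_self, Finset.sum_congr rfl
        (g := fun j => ε j • x j), ← add_assoc] at this
      · exact this
      · intro j hj
        rw [Function.update_of_ne (by rintro rfl; exact ha hj)]
    have h1 := key 1
    have h2 := key (-1)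
    have hca := abs_le.1 (hc a (Finset.mem_insert_self _ _))
    set S := ∑ j ∈ J, (c j : 𝕜) • x j
    have e : z + ∑ j ∈ insert a J, (c j : 𝕜) • x j
        = (((1 + c a) / 2 : ℝ) : 𝕜) • (z + (1 : ℤˣ) • x a + S)
          + (((1 - c a) / 2 : ℝ) : 𝕜) • (z + (-1 : ℤˣ) • x a + S) := by
      rw [Finset.sum_insert ha]
      simp only [one_smul, Units.neg_smul]
      push_cast
      module
    rw [e]
    calc _ ≤ (1 + c a) / 2 * W + (1 - c a) / 2 * W := by
          refine (norm_add_le _ _).trans ?_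
          rw [norm_smul, norm_smul, RCLike.norm_of_nonneg (by linarith),
            RCLike.norm_of_nonneg (by linarith)]
          have : 0 ≤ 1 + c a := by linarith
          have : 0 ≤ 1 - c a := by linarith
          gcongr
      _ = W := by ring

theorem norm_sum_real_smul_le (J : Finset ι) (x : ι → E) (W : ℝ) (c : ι → ℝ)
    (hc : ∀ j ∈ J, |c j| ≤ 1)
    (h : ∀ ε : ι → ℤˣ, ‖∑ j ∈ J, ε j • x j‖ ≤ W) :
    ‖∑ j ∈ J, (c j : 𝕜) • x j‖ ≤ W := by
  simpa using norm_add_sum_real_smul_le J x W c hc 0 (by simpa using h)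

theorem norm_sum_smul_le_two_mul (J : Finset ι) (x : ι → E) (W : ℝ) (c : ι → 𝕜)
    (hc : ∀ j ∈ J, ‖c j‖ ≤ 1)
    (h : ∀ ε : ι → ℤˣ, ‖∑ j ∈ J, ε j • x j‖ ≤ W) :
    ‖∑ j ∈ J, c j • x j‖ ≤ 2 * W := by
  have e : ∑ j ∈ J, c j • x j = ∑ j ∈ J, ((RCLike.re (c j) : ℝ) : 𝕜) • x j
      + (RCLike.I : 𝕜) • ∑ j ∈ J, ((RCLike.im (c j) : ℝ) : 𝕜) • x j := by
    rw [Finset.smul_sum, ← Finset.sum_add_distrib]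
    refine Finset.sum_congr rfl fun j _ => ?_
    conv_lhs => rw [← RCLike.re_add_im (c j)]
    rw [add_smul, smul_smul, mul_comm]
  rw [e, two_mul]
  refine (norm_add_le _ _).trans (add_le_add ?_ ?_)
  · exact norm_sum_real_smul_le J x W _ (fun j hj => (RCLike.abs_re_le_norm _).trans (hc j hj)) h
  · rw [norm_smul]
    have hI : ‖(RCLike.I : 𝕜)‖ ≤ 1 := by
      rcases RCLike.I_eq_zero_or_im_I_eq_one (K := 𝕜) with h0 | h0
      · simp [h0]
      · exact (RCLike.norm_I_of_ne_zero (by rintro h1; simp [h1] at h0)).le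
    have := norm_sum_real_smul_le (𝕜 := 𝕜) J x W (fun j => RCLike.im (c j))
      (fun j hj => (RCLike.abs_im_le_norm _).trans (hc j hj)) h
    calc _ ≤ 1 * W := by gcongr
      _ = W := one_mul W

/-- Finite sums along `g` are not increased by changes of signs. -/
def SignInvariant (𝕜 : Type*) {E ι : Type*} [RCLike 𝕜] [NormedAddCommGroup E] [NormedSpace 𝕜 E]
    (g : ι → E) : Prop :=
  ∀ (J : Finset ι) (a : ι → 𝕜) (ε : ι → ℤˣ),
    ‖∑ j ∈ J, ε j • (a j • g j)‖ ≤ ‖∑ j ∈ J, a j • g j‖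

/-- This replaces monotonicity of a lattice norm. The factor 2 comes from treating real and
imaginary parts of the multipliers separately. -/
theorem SignInvariant.norm_sum_le {g : ι → E} (hg : SignInvariant 𝕜 g) (J : Finset ι)
    (a b : ι → 𝕜) (h : ∀ j ∈ J, ‖a j‖ ≤ ‖b j‖) :
    ‖∑ j ∈ J, a j • g j‖ ≤ 2 * ‖∑ j ∈ J, b j • g j‖ := by
  have e : ∑ j ∈ J, a j • g j = ∑ j ∈ J, (a j / b j) • (b j • g j) := by
    refine Finset.sum_congr rfl fun j hj => ?_
    by_cases hb : b j = 0
    · have := h j hj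
      rw [hb, norm_zero] at this
      simp [hb, norm_le_zero_iff.1 this]
    · rw [smul_smul, div_mul_cancel₀ _ hb]
  rw [e]
  refine norm_sum_smul_le_two_mul J _ _ _ (fun j hj => ?_) (hg J b)
  rw [norm_div]
  exact div_le_one_of_le₀ (h j hj) (norm_nonneg _)

end Signs

/-! ### Consequences of 1-unconditionality -/

section Basis

variable {β 𝕜 E : Type*} [RCLike 𝕜] [NormedAddCommGroup E] [NormedSpace 𝕜 E]
  {L : SummationFilter β}

theorem GeneralSchauderBasis.coord_sum_smul [DecidableEq β] (e : GeneralSchauderBasis β 𝕜 E L)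
    (J : Finset β) (a : β → 𝕜) (k : β) :
    e.coord k (∑ j ∈ J, a j • e j) = if k ∈ J then a k else 0 := by
  simp [e.ortho, Pi.single_apply]

variable [L.NeBot] [L.LeAtTop] {e : GeneralSchauderBasis β 𝕜 E L}

/-- Two sign patterns that agree on `J` and are opposite off `J` give vectors of norm at most `‖x‖`,
whose average is the finite sum. -/
theorem IsOneUnconditional.norm_sum_signs_coord_le (he : IsOneUnconditional e) (J : Finset β)
    (x : E) (ε : β → ℤˣ) : ‖∑ j ∈ J, ε j • (e.coord j x • e j)‖ ≤ ‖x‖ := by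
  classical
  obtain ⟨y, hy, hyx⟩ := he x ε
  obtain ⟨y', hy', hyx'⟩ := he x (fun j => if j ∈ J then ε j else - ε j)
  have hs := hy.add hy'
  have hs' : HasSum (fun j => ε j • (e.coord j x • e j)
      + (if j ∈ J then ε j else - ε j) • (e.coord j x • e j))
      (∑ j ∈ J, (ε j • (e.coord j x • e j)
        + (if j ∈ J then ε j else - ε j) • (e.coord j x • e j))) L := by
    refine hasSum_sum_of_ne_finset_zero fun j hj => ?_
    rw [if_neg hj, Units.neg_smul, add_neg_cancel]
  have e1 := hs.unique hs'
  have e2 : ∑ j ∈ J, (ε j • (e.coord j x • e j)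
        + (if j ∈ J then ε j else - ε j) • (e.coord j x • e j))
      = (2 : 𝕜) • ∑ j ∈ J, ε j • (e.coord j x • e j) := by
    rw [Finset.smul_sum]
    refine Finset.sum_congr rfl fun j hj => ?_
    rw [if_pos hj, two_smul]
  rw [e2] at e1
  have h3 : ‖(2 : 𝕜) • ∑ j ∈ J, ε j • (e.coord j x • e j)‖ ≤ 2 * ‖x‖ := by
    rw [← e1]
    exact (norm_add_le _ _).trans (by linarith)
  rw [norm_smul, RCLike.norm_ofNat] at h3
  linarith

theorem IsOneUnconditional.signInvariant (he : IsOneUnconditional e) :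
    SignInvariant 𝕜 e := by
  classical
  intro J a ε
  have := he.norm_sum_signs_coord_le J (∑ j ∈ J, a j • e j) ε
  rwa [Finset.sum_congr rfl (g := fun j => ε j • (a j • e j))] at this
  intro j hj
  rw [e.coord_sum_smul, if_pos hj]

theorem IsOneUnconditional.norm_coord_le (he : IsOneUnconditional e) (he1 : ∀ j, ‖e j‖ = 1)
    (x : E) (k : β) : ‖e.coord k x‖ ≤ ‖x‖ := by
  have := he.norm_sum_signs_coord_le {k} x 1
  simpa [norm_smul, he1] using this

theorem IsOneUnconditional.norm_le_sum (he : IsOneUnconditional e) (he1 : ∀ j, ‖e j‖ = 1)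
    (J : Finset β) (t : β → 𝕜) {k : β} (hk : k ∈ J) : ‖t k‖ ≤ ‖∑ j ∈ J, t j • e j‖ := by
  classical
  have := he.norm_coord_le he1 (∑ j ∈ J, t j • e j) k
  rwa [e.coord_sum_smul, if_pos hk] at this

end Basis

/-! ### Rademacher averages and Khintchine's inequality -/

section Averages

variable {κ : Type*} [Fintype κ] [DecidableEq κ]

theorem sum_units_mul_units (k l : κ) :
    ∑ ε : κ → ℤˣ, ((ε k : ℤ) * (ε l : ℤ)) = if k = l then (2 : ℤ) ^ Fintype.card κ else 0 := by
  split_ifs with h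
  · subst h
    have : ∀ ε : κ → ℤˣ, ((ε k : ℤ) * (ε k : ℤ)) = 1 := by
      intro ε
      rcases Int.units_eq_one_or (ε k) with h | h <;> simp [h]
    simp [this]
  · refine Finset.sum_involution (fun ε _ => Function.update ε k (- ε k)) ?_ ?_ ?_ ?_
    · intro ε _
      rw [Function.update_self, Function.update_of_ne (Ne.symm h)]
      push_cast; ring
    · intro ε _ _ h2
      have := congrFun h2 k
      rw [Function.update_self] at this
      rcases Int.units_eq_one_or (ε k) with h | h <;> simp [h] at this
    · simp
    · intro ε _
      simp

theorem prod_add_eq_sum_signs {R : Type*} [CommRing R] (g : ℤˣ → κ → R) :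
    ∏ k, (g 1 k + g (-1) k) = ∑ ε : κ → ℤˣ, ∏ k, g (ε k) k := by
  rw [← Fintype.prod_sum (fun k u => g u k)]
  refine Finset.prod_congr rfl fun k _ => ?_
  rw [UnitsInt.univ, Finset.sum_insert (by decide), Finset.sum_singleton]

theorem sum_exp_signs_le (a : κ → ℝ) :
    ∑ ε : κ → ℤˣ, Real.exp (∑ k, (ε k : ℤ) * a k)
      ≤ 2 ^ Fintype.card κ * Real.exp ((∑ k, a k ^ 2) / 2) := by
  have h : ∑ ε : κ → ℤˣ, Real.exp (∑ k, (ε k : ℤ) * a k) = ∏ k, (2 * Real.cosh (a k)) := by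
    simp_rw [Real.exp_sum]
    rw [← prod_add_eq_sum_signs (fun u k => Real.exp ((u : ℤ) * a k))]
    refine Finset.prod_congr rfl fun k _ => ?_
    rw [Real.cosh_eq]
    simp only [Units.val_one, Int.cast_one, one_mul, Units.val_neg, Int.cast_neg, neg_mul]
    ring
  rw [h, Finset.prod_mul_distrib, Finset.prod_const, Finset.card_univ, Finset.sum_div,
    Real.exp_sum]
  gcongr with k
  · exact Real.cosh_le_exp_half_sq _

theorem sum_cos_signs (a : κ → ℝ) :
    ∑ ε : κ → ℤˣ, Real.cos (∑ k, (ε k : ℤ) * a k)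
      = 2 ^ Fintype.card κ * ∏ k, Real.cos (a k) := by
  have h : ∑ ε : κ → ℤˣ, Complex.exp ((∑ k, (ε k : ℤ) * a k : ℝ) * Complex.I)
      = ∏ k, (2 * Complex.cos (a k)) := by
    push_cast
    simp_rw [Finset.sum_mul, Complex.exp_sum]
    rw [← prod_add_eq_sum_signs (fun u k => Complex.exp ((u : ℤ) * a k * Complex.I))]
    refine Finset.prod_congr rfl fun k _ => ?_
    rw [Complex.two_cos]
    simp
  have h2 := congrArg Complex.re h
  rw [Finset.prod_mul_distrib, Finset.prod_const, Finset.card_univ, Complex.re_sum] at h2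
  simp_rw [Complex.exp_ofReal_mul_I_re] at h2
  rw [h2]
  have : (2 : ℂ) ^ Fintype.card κ * ∏ k, Complex.cos (a k)
      = ((2 ^ Fintype.card κ * ∏ k, Real.cos (a k) : ℝ) : ℂ) := by
    push_cast; rfl
  rw [this, Complex.ofReal_re]

/-- The lower Khintchine inequality in `L₁`, with a non-optimal constant. -/
theorem sqrt_sum_sq_le_sum_signs (a : κ → ℝ) :
    2 ^ Fintype.card κ * √(∑ k, a k ^ 2) ≤ 8 * ∑ ε : κ → ℤˣ, |∑ k, (ε k : ℤ) * a k| := by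
  set σ := √(∑ k, a k ^ 2) with hσ
  have hσ2 : σ ^ 2 = ∑ k, a k ^ 2 := Real.sq_sqrt (Finset.sum_nonneg fun _ _ => sq_nonneg _)
  rcases (Real.sqrt_nonneg (∑ k, a k ^ 2)).eq_or_lt with h0 | h0
  · rw [← hσ] at h0
    rw [← h0, mul_zero]; positivity
  rw [← hσ] at h0
  set b : κ → ℝ := fun k => a k / σ
  have hb2 : ∑ k, b k ^ 2 = 1 := by
    simp only [b, div_pow, ← Finset.sum_div, ← hσ2]
    exact div_self (by positivity)
  have hb1 : ∀ k, |b k| ≤ 1 := fun k => by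
    rw [abs_le_one_iff_mul_self_le_one, ← hb2, ← sq]
    exact Finset.single_le_sum (f := fun k => b k ^ 2) (fun _ _ => sq_nonneg _) (Finset.mem_univ k)
  -- With `∑ b k ^ 2 = 1`, the average of `cos (∑ ε k * b k)` is this product. Keeping it below 1
  -- bounds the first absolute moment from below, since `1 - cos y ≤ |y|`.
  have hcos : ∏ k, Real.cos (b k) ≤ 7 / 8 := by
    have hpi := Real.pi_gt_three
    have hpi4 := Real.pi_le_four
    calc ∏ k, Real.cos (b k) ≤ ∏ k, Real.exp (- (2 / Real.pi ^ 2 * b k ^ 2)) := by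
          refine Finset.prod_le_prod (fun k _ => ?_) fun k _ => ?_
          · have := abs_le.1 (hb1 k)
            exact Real.cos_nonneg_of_mem_Icc ⟨by linarith, by linarith⟩
          · have := Real.cos_le_one_sub_mul_cos_sq (x := b k) ((hb1 k).trans (by linarith))
            have h2 := Real.add_one_le_exp (- (2 / Real.pi ^ 2 * b k ^ 2))
            linarith
      _ = Real.exp (-(2 / Real.pi ^ 2)) := by
          rw [← Real.exp_sum, Finset.sum_neg_distrib, ← Finset.mul_sum, hb2, mul_one]
      _ ≤ 7 / 8 := by
          have h3 : (1 : ℝ) / 7 ≤ 2 / Real.pi ^ 2 := by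
            rw [div_le_div_iff₀ (by norm_num) (by positivity)]
            nlinarith [Real.pi_lt_d2]
          have h4 := Real.add_one_le_exp (2 / Real.pi ^ 2)
          rw [Real.exp_neg, inv_le_comm₀ (Real.exp_pos _) (by norm_num)]
          norm_num
          linarith
  have hone : ∀ y : ℝ, 1 - Real.cos y ≤ |y| := by
    intro y
    by_cases hy : |y| ≤ 2
    · have := Real.one_sub_sq_div_two_le_cos (x := y)
      have h4 : y ^ 2 = |y| * |y| := by rw [← sq, sq_abs]
      nlinarith [abs_nonneg y]
    · have := Real.neg_one_le_cos y
      linarith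
  have hsum : ∑ ε : κ → ℤˣ, (1 - Real.cos (∑ k, (ε k : ℤ) * b k))
      ≤ ∑ ε : κ → ℤˣ, |∑ k, (ε k : ℤ) * b k| := Finset.sum_le_sum fun _ _ => hone _
  rw [Finset.sum_sub_distrib, sum_cos_signs] at hsum
  have hrel : ∑ ε : κ → ℤˣ, |∑ k, (ε k : ℤ) * a k|
      = σ * ∑ ε : κ → ℤˣ, |∑ k, (ε k : ℤ) * b k| := by
    rw [Finset.mul_sum]
    refine Finset.sum_congr rfl fun ε _ => ?_
    conv_rhs => rw [← abs_of_pos h0]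
    rw [← abs_mul, Finset.mul_sum]
    congr 1
    refine Finset.sum_congr rfl fun k _ => ?_
    simp only [b]
    field_simp
  have hc : ∑ _ε : κ → ℤˣ, (1 : ℝ) = 2 ^ Fintype.card κ := by simp
  rw [hc] at hsum
  have hp : (0 : ℝ) < 2 ^ Fintype.card κ := by positivity
  have : 2 ^ Fintype.card κ * (1 / 8) ≤ ∑ ε : κ → ℤˣ, |∑ k, (ε k : ℤ) * b k| := by
    nlinarith
  rw [hrel]
  nlinarith

end Averages

/-! ### Exponential moments, and cotype applied to rare coefficients -/

section SquareFunction

variable {𝕜 H ι κ : Type*} [RCLike 𝕜] [NormedAddCommGroup H] [NormedSpace 𝕜 H]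

/-- Rademacher sums are subgaussian. Real and imaginary parts are separated by `exp (p + q) ≤ (exp
(2 * p) + exp (2 * q)) / 2`, hence the factor 2 in the exponent of `aux`. -/
theorem sum_exp_norm_signs_le [Fintype κ] [DecidableEq κ] (a : κ → 𝕜)
    (ha : ∑ k, ‖a k‖ ^ 2 ≤ 1) :
    ∑ ε : κ → ℤˣ, Real.exp ‖∑ k, ((ε k : ℤ) : 𝕜) * a k‖ ≤ 16 * 2 ^ Fintype.card κ := by
  have aux : ∀ b : κ → ℝ, (∀ k, |b k| ≤ ‖a k‖) →
      ∑ ε : κ → ℤˣ, Real.exp (2 * |∑ k, (ε k : ℤ) * b k|) ≤ 16 * 2 ^ Fintype.card κ := by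
    intro b hb
    have hb2 : ∀ s : ℝ, s ^ 2 = 1 → ∑ ε : κ → ℤˣ, Real.exp (∑ k, (ε k : ℤ) * (2 * s * b k))
        ≤ 2 ^ Fintype.card κ * 8 := by
      intro s hs
      refine (sum_exp_signs_le _).trans ?_
      gcongr
      have h1 : ∑ k, (2 * s * b k) ^ 2 ≤ 4 := by
        calc ∑ k, (2 * s * b k) ^ 2 = 4 * ∑ k, b k ^ 2 := by
              rw [Finset.mul_sum]
              refine Finset.sum_congr rfl fun k _ => ?_
              rw [mul_pow, mul_pow, hs]; ring
          _ ≤ 4 * ∑ k, ‖a k‖ ^ 2 := by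
              refine mul_le_mul_of_nonneg_left (Finset.sum_le_sum fun k _ => ?_) (by norm_num)
              exact sq_le_sq' (by linarith [neg_abs_le (b k), hb k]) ((le_abs_self _).trans (hb k))
          _ ≤ 4 := by linarith
      calc Real.exp ((∑ k, (2 * s * b k) ^ 2) / 2) ≤ Real.exp 2 := by
            gcongr; linarith
        _ = Real.exp 1 ^ 2 := by rw [← Real.exp_nat_mul]; norm_num
        _ ≤ 2.7182818286 ^ 2 := by gcongr; exact Real.exp_one_lt_d9.le
        _ ≤ 8 := by norm_num
    have h1 := hb2 1 (by norm_num)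
    have h2 := hb2 (-1) (by norm_num)
    calc _ ≤ ∑ ε : κ → ℤˣ, (Real.exp (∑ k, (ε k : ℤ) * (2 * 1 * b k))
          + Real.exp (∑ k, (ε k : ℤ) * (2 * (-1) * b k))) := by
          refine Finset.sum_le_sum fun ε _ => ?_
          have e1 : ∑ k, (ε k : ℤ) * (2 * 1 * b k) = 2 * ∑ k, (ε k : ℤ) * b k := by
            rw [Finset.mul_sum]; exact Finset.sum_congr rfl fun k _ => by ring
          have e2 : ∑ k, (ε k : ℤ) * (2 * (-1) * b k) = -(2 * ∑ k, (ε k : ℤ) * b k) := by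
            rw [Finset.mul_sum, ← Finset.sum_neg_distrib]
            exact Finset.sum_congr rfl fun k _ => by ring
          rw [e1, e2]
          rcases abs_cases (∑ k, ((ε k : ℤ) : ℝ) * b k) with ⟨h, _⟩ | ⟨h, _⟩
          · rw [h]; linarith [Real.exp_pos (-(2 * ∑ k, ((ε k : ℤ) : ℝ) * b k))]
          · rw [h, mul_neg]; linarith [Real.exp_pos (2 * ∑ k, ((ε k : ℤ) : ℝ) * b k)]
      _ ≤ 16 * 2 ^ Fintype.card κ := by
          rw [Finset.sum_add_distrib]; linarith
  have h1 := aux (fun k => RCLike.re (a k)) fun k => RCLike.abs_re_le_norm _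
  have h2 := aux (fun k => RCLike.im (a k)) fun k => RCLike.abs_im_le_norm _
  have h3 : ∑ ε : κ → ℤˣ, Real.exp ‖∑ k, ((ε k : ℤ) : 𝕜) * a k‖
      ≤ ∑ ε : κ → ℤˣ, (Real.exp (2 * |∑ k, (ε k : ℤ) * RCLike.re (a k)|)
        + Real.exp (2 * |∑ k, (ε k : ℤ) * RCLike.im (a k)|)) / 2 := by
    refine Finset.sum_le_sum fun ε _ => ?_
    have hcast : ∀ k, ((ε k : ℤ) : 𝕜) = (((ε k : ℤ) : ℝ) : 𝕜) := fun k => by push_cast; rfl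
    have hre : RCLike.re (∑ k, ((ε k : ℤ) : 𝕜) * a k) = ∑ k, (ε k : ℤ) * RCLike.re (a k) := by
      rw [map_sum]
      exact Finset.sum_congr rfl fun k _ => by rw [hcast, RCLike.re_ofReal_mul]
    have him : RCLike.im (∑ k, ((ε k : ℤ) : 𝕜) * a k) = ∑ k, (ε k : ℤ) * RCLike.im (a k) := by
      rw [map_sum]
      exact Finset.sum_congr rfl fun k _ => by rw [hcast, RCLike.im_ofReal_mul]
    have hn := RCLike.norm_sq_eq_def (z := ∑ k, ((ε k : ℤ) : 𝕜) * a k)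
    rw [← sq, ← sq, ← sq_abs (RCLike.re _), ← sq_abs (RCLike.im _)] at hn
    replace hn := abs_le_of_sq_le_sq (a := ‖∑ k, ((ε k : ℤ) : 𝕜) * a k‖)
      (b := |RCLike.re (∑ k, ((ε k : ℤ) : 𝕜) * a k)| + |RCLike.im (∑ k, ((ε k : ℤ) : 𝕜) * a k)|)
      (by rw [hn]; nlinarith [abs_nonneg (RCLike.re (∑ k, ((ε k : ℤ) : 𝕜) * a k)),
            abs_nonneg (RCLike.im (∑ k, ((ε k : ℤ) : 𝕜) * a k))]) (by positivity)
    rw [abs_of_nonneg (norm_nonneg _)] at hn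
    rw [hre, him] at hn
    set p := |∑ k, ((ε k : ℤ) : ℝ) * RCLike.re (a k)|
    set q := |∑ k, ((ε k : ℤ) : ℝ) * RCLike.im (a k)|
    calc Real.exp _ ≤ Real.exp (p + q) := Real.exp_le_exp.2 hn
      _ = Real.exp p * Real.exp q := Real.exp_add _ _
      _ ≤ (Real.exp p ^ 2 + Real.exp q ^ 2) / 2 := by
          nlinarith [sq_nonneg (Real.exp p - Real.exp q)]
      _ = _ := by
          rw [← Real.exp_nat_mul, ← Real.exp_nat_mul]; norm_num
  refine h3.trans ?_
  rw [← Finset.sum_div, Finset.sum_add_distrib]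
  linarith

/-- The cotype inequality with a given constant. -/
def CotypeBound (H : Type*) [NormedAddCommGroup H] (r C : ℝ) : Prop :=
  ∀ (n : ℕ) (x : Fin n → H),
    (∑ i, ‖x i‖ ^ r) ^ (1 / r) ≤ C * ((∑ ε : Fin n → ℤˣ, ‖∑ i, ε i • x i‖) / 2 ^ n)

theorem HasCotype.exists_bound {r : ℝ} (h : HasCotype H r) : ∃ C, 0 ≤ C ∧ CotypeBound H r C := by
  obtain ⟨C, hC⟩ := h
  refine ⟨max C 0, le_max_right _ _, fun n x => (hC n x).trans ?_⟩
  gcongr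
  exact le_max_left _ _

/-- Cotype bounds the `ℓ_r` sum of the norms, and the power mean inequality turns this into a gain
of `n ^ (1 / r)` over the trivial bound for the `ℓ_1` sum. -/
theorem CotypeBound.sum_norm_le {r C W : ℝ} (hC : CotypeBound H r C) (hC0 : 0 ≤ C) (hr : 1 ≤ r)
    {n : ℕ} (y : Fin n → H) (hy : ∀ ε : Fin n → ℤˣ, ‖∑ i, ε i • y i‖ ≤ W) :
    (∑ i, ‖y i‖) * (n : ℝ) ^ (1 / r) ≤ n * (C * W) := by
  rcases Nat.eq_zero_or_pos n with rfl | hn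
  · simp
  have hn' : (0 : ℝ) < n := by exact_mod_cast hn
  have hr0 : (0 : ℝ) < r := by linarith
  have h1 : (∑ i, ‖y i‖ ^ r) ^ (1 / r) ≤ C * W := by
    refine (hC n y).trans ?_
    gcongr
    rw [div_le_iff₀ (by positivity)]
    calc _ ≤ ∑ _ε : Fin n → ℤˣ, W := Finset.sum_le_sum fun ε _ => hy ε
      _ = W * 2 ^ n := by simp [mul_comm]
  have h2 := Real.rpow_sum_le_const_mul_sum_rpow_of_nonneg (s := Finset.univ)
    (f := fun i => ‖y i‖) hr (fun i _ => norm_nonneg _)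
  rw [Finset.card_univ, Fintype.card_fin] at h2
  have hS : 0 ≤ ∑ i, ‖y i‖ := Finset.sum_nonneg fun _ _ => norm_nonneg _
  have hT : 0 ≤ ∑ i, ‖y i‖ ^ r := Finset.sum_nonneg fun _ _ => by positivity
  have h3 : ∑ i, ‖y i‖ ≤ (n : ℝ) ^ ((r - 1) * (1 / r)) * (∑ i, ‖y i‖ ^ r) ^ (1 / r) := by
    have := Real.rpow_le_rpow (by positivity) h2 (z := 1 / r) (by positivity)
    rwa [← Real.rpow_mul hS, mul_one_div_cancel hr0.ne', Real.rpow_one,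
      Real.mul_rpow (by positivity) hT, ← Real.rpow_mul hn'.le] at this
  calc (∑ i, ‖y i‖) * (n : ℝ) ^ (1 / r)
      ≤ (n : ℝ) ^ ((r - 1) * (1 / r)) * (C * W) * (n : ℝ) ^ (1 / r) := by
        gcongr
        exact h3.trans (by gcongr)
    _ = ((n : ℝ) ^ ((r - 1) * (1 / r)) * (n : ℝ) ^ (1 / r)) * (C * W) := by ring
    _ = n * (C * W) := by
        rw [← Real.rpow_add hn']
        have : (r - 1) * (1 / r) + 1 / r = 1 := by field_simp; ring
        rw [this, Real.rpow_one]

open Classical in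
/-- If random coefficients of modulus at most one are rarely different from zero, then, in a space
of finite cotype, the random sums are small on average. -/
theorem CotypeBound.sum_norm_rare_le {r C W : ℝ} (hC : CotypeBound H r C) (hC0 : 0 ≤ C)
    (hr : 1 ≤ r) {Ω : Type*} [Fintype Ω] [Nonempty Ω] (J : Finset ι) (x : ι → H)
    (hx : ∀ c : ι → 𝕜, (∀ j, ‖c j‖ ≤ 1) → ‖∑ j ∈ J, c j • x j‖ ≤ W)
    (c : Ω → ι → 𝕜) (hc : ∀ ω j, ‖c ω j‖ ≤ 1) (m : ℕ)
    (hm : ∀ j ∈ J, 2 * m * (Finset.univ.filter fun ω => c ω j ≠ 0).card ≤ Fintype.card Ω) :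
    (∑ ω, ‖∑ j ∈ J, c ω j • x j‖) * ((m + 1 : ℕ) : ℝ) ^ (1 / r)
      ≤ 2 * (C * W) * Fintype.card Ω := by
  set N := (Fintype.card Ω : ℝ) with hN
  have hN0 : 0 < N := by simpa [hN] using Fintype.card_pos
  -- Here `q j` counts the outcomes at which coefficient `j` vanishes. Bernoulli's inequality shows
  -- that `m` independent copies all vanish at `j` with probability at least one half.
  set q : ι → ℝ := fun j => ∑ ω, if c ω j = 0 then 1 else 0 with hq
  have hqN : ∀ j ∈ J, N ^ m / 2 ≤ q j ^ m := by
    intro j hj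
    set n := ((Finset.univ.filter fun ω => c ω j ≠ 0).card : ℝ)
    have h1 : q j = N - n := by
      have := Finset.card_filter_add_card_filter_not (s := (Finset.univ : Finset Ω))
        (fun ω => c ω j = 0)
      simp only [hq]
      rw [Finset.sum_boole, hN, ← Finset.card_univ, ← this]
      push_cast
      ring
    have h2 : 2 * (m : ℝ) * n ≤ N := by
      have := (Nat.cast_le (α := ℝ)).2 (hm j hj)
      rwa [Nat.cast_mul, Nat.cast_mul, Nat.cast_ofNat] at this
    have hnN : n ≤ N := by
      have h0 : 0 ≤ q j := Finset.sum_nonneg fun _ _ => by positivity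
      linarith
    have h3 := one_add_mul_le_pow (a := -(n / N)) (by
      have : n / N ≤ 1 := div_le_one_of_le₀ hnN hN0.le
      linarith) m
    have h4 : (m : ℝ) * (n / N) ≤ 1 / 2 := by
      rw [← mul_div_assoc, div_le_iff₀ hN0]; linarith
    have h5 : q j = N * (1 + -(n / N)) := by rw [h1]; field_simp; ring
    rw [h5, mul_pow, div_eq_mul_one_div]
    gcongr
    linarith
  have hqpos : ∀ j ∈ J, 0 < q j ^ m := fun j hj => lt_of_lt_of_le (by positivity) (hqN j hj)
  -- The damping equalizes these probabilities over `j`: `w j * q j ^ m = N ^ m / 2`.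
  set w : ι → ℝ := fun j => if j ∈ J then N ^ m / 2 / q j ^ m else 0 with hw
  have hw1 : ∀ j, |w j| ≤ 1 := by
    intro j
    by_cases hj : j ∈ J
    · have := hqpos j hj
      simp only [hw, if_pos hj]
      rw [abs_of_nonneg (by positivity), div_le_one this]
      exact hqN j hj
    · simp [hw, hj]
  -- Take `m + 1` independent copies and keep coefficient `j` of the `i`-th copy only where all
  -- other copies vanish. The supports become disjoint, so signed sums over `i` still have
  -- coefficients of modulus at most one and cotype applies.
  set d : (Fin (m + 1) → Ω) → Fin (m + 1) → ι → 𝕜 := fun τ i j =>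
    (∏ l : {l // l ≠ i}, if c (τ l) j = 0 then 1 else 0) * ((w j : 𝕜) * c (τ i) j) with hd
  have hd1 : ∀ τ i j, ‖d τ i j‖ ≤ 1 := by
    intro τ i j
    simp only [hd, norm_mul, norm_prod, RCLike.norm_ofReal]
    have h1 : ∏ l : {l // l ≠ i}, ‖(if c (τ l) j = 0 then 1 else 0 : 𝕜)‖ ≤ 1 :=
      Finset.prod_le_one (fun _ _ => norm_nonneg _) fun l _ => by split_ifs <;> simp
    have h0 : 0 ≤ ∏ l : {l // l ≠ i}, ‖(if c (τ l) j = 0 then 1 else 0 : 𝕜)‖ :=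
      Finset.prod_nonneg fun _ _ => norm_nonneg _
    exact mul_le_one₀ h1 (by positivity)
      (mul_le_one₀ (hw1 j) (norm_nonneg _) (hc _ _))
  have hd0 : ∀ τ i i' j, i ≠ i' → d τ i j ≠ 0 → d τ i' j = 0 := by
    intro τ i i' j hii h
    have hne : c (τ i) j ≠ 0 := by
      intro h0
      exact h (by simp [hd, h0])
    simp only [hd]
    rw [Finset.prod_eq_zero (Finset.mem_univ (⟨i, hii⟩ : {l // l ≠ i'})), zero_mul]
    simp [hne]
  set y : (Fin (m + 1) → Ω) → Fin (m + 1) → H := fun τ i => ∑ j ∈ J, d τ i j • x j with hy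
  have hyW : ∀ τ (ε : Fin (m + 1) → ℤˣ), ‖∑ i, ε i • y τ i‖ ≤ W := by
    intro τ ε
    have e : ∑ i, ε i • y τ i = ∑ j ∈ J, (∑ i, ((ε i : ℤ) : 𝕜) * d τ i j) • x j := by
      simp_rw [Finset.sum_smul]
      rw [Finset.sum_comm]
      refine Finset.sum_congr rfl fun i _ => ?_
      rw [units_smul_eq_smul 𝕜, hy, Finset.smul_sum]
      exact Finset.sum_congr rfl fun j _ => smul_smul _ _ _
    rw [e]
    refine hx _ fun j => ?_
    by_cases h : ∃ i, d τ i j ≠ 0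
    · obtain ⟨i, hi⟩ := h
      rw [Finset.sum_eq_single i (fun i' _ hii => by rw [hd0 τ i i' j hii.symm hi, mul_zero])
        (by simp), norm_mul, norm_units_cast, one_mul]
      exact hd1 _ _ _
    · push Not at h
      simp [h]
  have hsum : ∀ τ, (∑ i, ‖y τ i‖) * ((m + 1 : ℕ) : ℝ) ^ (1 / r) ≤ (m + 1 : ℕ) * (C * W) :=
    fun τ => hC.sum_norm_le hC0 hr (y τ) (hyW τ)
  -- Summing over all copies except the `i`-th restores the original random sum up to the factor `N
  -- ^ m / 2`.
  have hlow : ∀ i, N ^ m / 2 * ∑ ω, ‖∑ j ∈ J, c ω j • x j‖ ≤ ∑ τ, ‖y τ i‖ := by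
    intro i
    rw [← (Equiv.funSplitAt i Ω).symm.sum_comp, Fintype.sum_prod_type, Finset.mul_sum]
    refine Finset.sum_le_sum fun ω _ => ?_
    have e : ∑ σ : {l // l ≠ i} → Ω, y ((Equiv.funSplitAt i Ω).symm (ω, σ)) i
        = ((N ^ m / 2 : ℝ) : 𝕜) • ∑ j ∈ J, c ω j • x j := by
      simp only [hy]
      rw [Finset.sum_comm, Finset.smul_sum]
      refine Finset.sum_congr rfl fun j hj => ?_
      rw [← Finset.sum_smul, smul_smul]
      congr 1
      have hτ : ∀ σ : {l // l ≠ i} → Ω, d ((Equiv.funSplitAt i Ω).symm (ω, σ)) i j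
          = (∏ l : {l // l ≠ i}, if c (σ l) j = 0 then 1 else 0) * ((w j : 𝕜) * c ω j) := by
        intro σ
        simp only [hd]
        congr 1
        · refine Finset.prod_congr rfl fun l _ => ?_
          rw [Equiv.funSplitAt_symm_apply, dif_neg l.2]
        · rw [Equiv.funSplitAt_symm_apply, dif_pos rfl]
      simp_rw [hτ]
      rw [← Finset.sum_mul, ← Fintype.prod_sum (fun (_ : {l // l ≠ i}) (ω : Ω) =>
        (if c ω j = 0 then 1 else 0 : 𝕜)), Finset.prod_const, Finset.card_univ]
      have hcard : Fintype.card {l // l ≠ i} = m := by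
        simp [Fintype.card_subtype_compl]
      have hq' : (∑ ω, if c ω j = 0 then 1 else 0 : 𝕜) = (q j : 𝕜) := by
        simp [hq]
      rw [hcard, hq', ← mul_assoc]
      congr 1
      simp only [hw, if_pos hj]
      have := (hqpos j hj).ne'
      rw [← RCLike.ofReal_pow, ← RCLike.ofReal_mul]
      congr 1
      field_simp
    calc N ^ m / 2 * ‖∑ j ∈ J, c ω j • x j‖
        = ‖((N ^ m / 2 : ℝ) : 𝕜) • ∑ j ∈ J, c ω j • x j‖ := by
          rw [norm_smul, RCLike.norm_of_nonneg (by positivity)]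
      _ ≤ _ := by rw [← e]; exact norm_sum_le _ _
  set S := ∑ ω, ‖∑ j ∈ J, c ω j • x j‖
  set R := ((m + 1 : ℕ) : ℝ) ^ (1 / r)
  have hR : 0 ≤ R := by positivity
  have hfin : ((m + 1 : ℕ) : ℝ) * (N ^ m / 2 * S) * R ≤ N ^ (m + 1) * ((m + 1 : ℕ) * (C * W)) := by
    calc ((m + 1 : ℕ) : ℝ) * (N ^ m / 2 * S) * R
        = (∑ _i : Fin (m + 1), N ^ m / 2 * S) * R := by simp
      _ ≤ (∑ i : Fin (m + 1), ∑ τ, ‖y τ i‖) * R := by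
          gcongr with i; exact hlow i
      _ = ∑ τ, (∑ i, ‖y τ i‖) * R := by rw [Finset.sum_comm, Finset.sum_mul]
      _ ≤ ∑ _τ : Fin (m + 1) → Ω, ((m + 1 : ℕ) : ℝ) * (C * W) :=
          Finset.sum_le_sum fun τ _ => hsum τ
      _ = _ := by simp [hN]
  have hpos : 0 < ((m + 1 : ℕ) : ℝ) * (N ^ m / 2) := by positivity
  refine le_of_mul_le_mul_left ?_ hpos
  calc _ = ((m + 1 : ℕ) : ℝ) * (N ^ m / 2 * S) * R := by ring
    _ ≤ _ := hfin
    _ = _ := by rw [pow_succ]; ring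

end SquareFunction

/-! ### Maurey's square function estimate -/

section SquareFunction

variable {𝕜 H ι κ : Type*} [RCLike 𝕜] [NormedAddCommGroup H] [NormedSpace 𝕜 H]

/-- The constant in the square function estimate for spaces of cotype `r`. -/
noncomputable def squareFunctionConst (r C : ℝ) : ℝ :=
  64 * C * ∑' m : ℕ, ((m : ℝ) + 1) * Real.exp (-(1 / r)) ^ m

theorem summable_add_one_mul_exp_pow {r : ℝ} (hr : 0 < r) :
    Summable fun m : ℕ => ((m : ℝ) + 1) * Real.exp (-(1 / r)) ^ m := by
  have h : ‖Real.exp (-(1 / r))‖ < 1 := by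
    rw [Real.norm_of_nonneg (Real.exp_pos _).le, Real.exp_lt_one_iff]
    have : 0 < 1 / r := by positivity
    linarith
  have h1 := summable_pow_mul_geometric_of_norm_lt_one 1 h
  have h2 := summable_geometric_of_norm_lt_one h
  refine (h1.add h2).congr fun m => ?_
  rw [pow_one]; ring

theorem squareFunctionConst_nonneg {r C : ℝ} (hC0 : 0 ≤ C) : 0 ≤ squareFunctionConst r C := by
  have : 0 ≤ ∑' m : ℕ, ((m : ℝ) + 1) * Real.exp (-(1 / r)) ^ m :=
    tsum_nonneg fun m => by positivity
  unfold squareFunctionConst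
  positivity

open Classical in
/-- Maurey's square function estimate for operators from `C(K)` into a space of finite cotype. -/
theorem CotypeBound.sum_signs_norm_le {r C W : ℝ} (hC : CotypeBound H r C) (hC0 : 0 ≤ C)
    (hr : 1 ≤ r) [Fintype κ] (J : Finset ι) (x : ι → H)
    (hx : ∀ c : ι → 𝕜, (∀ j, ‖c j‖ ≤ 1) → ‖∑ j ∈ J, c j • x j‖ ≤ W)
    (a : κ → ι → 𝕜) (ha : ∀ j, ∑ k, ‖a k j‖ ^ 2 ≤ 1) :
    ∑ ε : κ → ℤˣ, ‖∑ j ∈ J, (∑ k, ((ε k : ℤ) : 𝕜) * a k j) • x j‖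
      ≤ squareFunctionConst r C * W * 2 ^ Fintype.card κ := by
  have hr0 : 0 < r := by linarith
  have hW : 0 ≤ W := (norm_nonneg _).trans (hx 0 (by simp))
  set N := (2 : ℝ) ^ Fintype.card κ with hN
  have hcard : (Fintype.card (κ → ℤˣ) : ℝ) = N := by simp [hN]
  set S : (κ → ℤˣ) → ι → 𝕜 := fun ε j => ∑ k, ((ε k : ℤ) : 𝕜) * a k j with hS
  -- The random coefficient is sliced by the integer part of its modulus, and each slice is scaled
  -- into the unit ball.
  set c : ℕ → (κ → ℤˣ) → ι → 𝕜 := fun m ε j =>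
    if ⌊‖S ε j‖⌋₊ = m then (((m : ℝ) + 1 : ℝ) : 𝕜)⁻¹ * S ε j else 0 with hc
  have hc1 : ∀ m ε j, ‖c m ε j‖ ≤ 1 := by
    intro m ε j
    simp only [hc]
    split_ifs with h
    · have := Nat.lt_floor_add_one ‖S ε j‖
      rw [h] at this
      rw [norm_mul, norm_inv, RCLike.norm_of_nonneg (by positivity), inv_mul_le_iff₀ (by positivity)]
      linarith
    · simp
  have hlevel : ∀ m : ℕ, ∑ ε, ‖∑ j ∈ J, c m ε j • x j‖
      ≤ 64 * C * W * N * Real.exp (-(1 / r)) ^ m := by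
    intro m
    -- By the exponential moment, slice `m` is nonzero with probability at most `16 * exp (-m)`.
    -- This is the largest natural `p` for which that bound gives `2 * p` times the probability at
    -- most 1.
    set p := ⌊Real.exp m / 32⌋₊
    have hp : (p : ℝ) ≤ Real.exp m / 32 := Nat.floor_le (by positivity)
    have hp1 : Real.exp m / 32 ≤ ((p + 1 : ℕ) : ℝ) := by
      push_cast; exact (Nat.lt_floor_add_one _).le
    have hrare : ∀ j ∈ J, 2 * p * (Finset.univ.filter fun ε => c m ε j ≠ 0).card
        ≤ Fintype.card (κ → ℤˣ) := by
      intro j _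
      have h1 : ((Finset.univ.filter fun ε => c m ε j ≠ 0).card : ℝ) * Real.exp m ≤ 16 * N := by
        refine le_trans ?_ (sum_exp_norm_signs_le (fun k => a k j) (ha j))
        rw [← nsmul_eq_mul, ← Finset.sum_const]
        refine (Finset.sum_le_sum (g := fun ε => Real.exp ‖S ε j‖) fun ε hε => ?_).trans
          (Finset.sum_le_sum_of_subset_of_nonneg (Finset.filter_subset _ _)
            fun _ _ _ => (Real.exp_pos _).le)
        have hne := (Finset.mem_filter.1 hε).2
        have hfl : ⌊‖S ε j‖⌋₊ = m := by
          by_contra h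
          exact hne (by simp only [hc, if_neg h])
        rw [Real.exp_le_exp, ← hfl]
        exact Nat.floor_le (norm_nonneg _)
      have h2 : (2 * p * (Finset.univ.filter fun ε => c m ε j ≠ 0).card : ℝ)
          ≤ Fintype.card (κ → ℤˣ) := by
        rw [hcard]
        calc (2 * p * (Finset.univ.filter fun ε => c m ε j ≠ 0).card : ℝ)
            ≤ 2 * (Real.exp m / 32) * (Finset.univ.filter fun ε => c m ε j ≠ 0).card := by
              gcongr
          _ ≤ N := by linarith
      exact_mod_cast h2
    have h := hC.sum_norm_rare_le hC0 hr J x hx (c m) (hc1 m) p hrare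
    rw [hcard] at h
    set T := ∑ ε, ‖∑ j ∈ J, c m ε j • x j‖
    have hT : 0 ≤ T := Finset.sum_nonneg fun _ _ => norm_nonneg _
    have hpow : Real.exp (1 / r) ^ m / 32 ≤ ((p + 1 : ℕ) : ℝ) ^ (1 / r) := by
      have h32 : (32 : ℝ) ^ (1 / r) ≤ 32 :=
        Real.rpow_le_self_of_one_le (by norm_num) (by rw [div_le_one hr0]; exact hr)
      have hexp : Real.exp m ^ (1 / r) = Real.exp (1 / r) ^ m := by
        rw [← Real.exp_mul, ← Real.exp_nat_mul]
      calc Real.exp (1 / r) ^ m / 32 ≤ Real.exp (1 / r) ^ m / 32 ^ (1 / r) := by gcongr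
        _ = (Real.exp m / 32) ^ (1 / r) := by
            rw [Real.div_rpow (Real.exp_pos _).le (by norm_num), hexp]
        _ ≤ _ := by gcongr
    have h3 : T * (Real.exp (1 / r) ^ m / 32) ≤ 2 * (C * W) * N :=
      le_trans (by gcongr) h
    have h4 : Real.exp (-(1 / r)) ^ m * Real.exp (1 / r) ^ m = 1 := by
      rw [← mul_pow, ← Real.exp_add, neg_add_cancel, Real.exp_zero, one_pow]
    have h5 : 0 ≤ Real.exp (-(1 / r)) ^ m := by positivity
    calc T = 32 * Real.exp (-(1 / r)) ^ m * (T * (Real.exp (1 / r) ^ m / 32)) := by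
          linear_combination (-T) * h4
      _ ≤ 32 * Real.exp (-(1 / r)) ^ m * (2 * (C * W) * N) := by gcongr
      _ = _ := by ring
  obtain ⟨B, hB⟩ : ∃ B : ℕ, ∀ ε, ∀ j ∈ J, ⌊‖S ε j‖⌋₊ < B := by
    refine ⟨(∑ ε, ∑ j ∈ J, ⌊‖S ε j‖⌋₊) + 1, fun ε j hj => Nat.lt_succ_of_le ?_⟩
    refine (Finset.single_le_sum (f := fun j => ⌊‖S ε j‖⌋₊) (fun _ _ => Nat.zero_le _) hj).trans ?_
    exact Finset.single_le_sum (f := fun ε => ∑ j ∈ J, ⌊‖S ε j‖⌋₊)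
      (fun _ _ => Nat.zero_le _) (Finset.mem_univ ε)
  have hdecomp : ∀ ε, ∑ j ∈ J, S ε j • x j
      = ∑ m ∈ Finset.range B, (((m : ℝ) + 1 : ℝ) : 𝕜) • ∑ j ∈ J, c m ε j • x j := by
    intro ε
    simp_rw [Finset.smul_sum]
    rw [Finset.sum_comm]
    refine Finset.sum_congr rfl fun j hj => ?_
    rw [Finset.sum_eq_single ⌊‖S ε j‖⌋₊]
    · simp only [hc, if_true]
      rw [smul_smul, mul_inv_cancel_left₀]
      rw [RCLike.ofReal_ne_zero]
      positivity
    · intro m _ hm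
      simp only [hc, if_neg hm.symm, zero_smul, smul_zero]
    · intro h
      exact absurd (Finset.mem_range.2 (hB ε j hj)) h
  calc ∑ ε, ‖∑ j ∈ J, S ε j • x j‖
      ≤ ∑ ε, ∑ m ∈ Finset.range B, ((m : ℝ) + 1) * ‖∑ j ∈ J, c m ε j • x j‖ := by
        refine Finset.sum_le_sum fun ε _ => ?_
        rw [hdecomp]
        refine (norm_sum_le _ _).trans (Finset.sum_le_sum fun m _ => ?_)
        rw [norm_smul, RCLike.norm_of_nonneg (by positivity)]
    _ = ∑ m ∈ Finset.range B, ((m : ℝ) + 1) * ∑ ε, ‖∑ j ∈ J, c m ε j • x j‖ := by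
        rw [Finset.sum_comm]
        simp_rw [Finset.mul_sum]
    _ ≤ ∑ m ∈ Finset.range B, ((m : ℝ) + 1) * (64 * C * W * N * Real.exp (-(1 / r)) ^ m) := by
        gcongr with m
        exact hlevel m
    _ = 64 * C * W * N * ∑ m ∈ Finset.range B, ((m : ℝ) + 1) * Real.exp (-(1 / r)) ^ m := by
        rw [Finset.mul_sum]
        exact Finset.sum_congr rfl fun m _ => by ring
    _ ≤ 64 * C * W * N * ∑' m : ℕ, ((m : ℝ) + 1) * Real.exp (-(1 / r)) ^ m := by
        gcongr
        exact (summable_add_one_mul_exp_pow hr0).sum_le_tsum _ fun m _ => by positivity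
    _ = _ := by rw [squareFunctionConst]; ring

end SquareFunction

/-! ### Square functions and diagonals of operators -/

section Operators

variable {𝕜 : Type*} [RCLike 𝕜]

theorem sqrt_sum_norm_sq_le_sum_signs {κ : Type*} [Fintype κ] [DecidableEq κ] (a : κ → 𝕜) :
    2 ^ Fintype.card κ * √(∑ k, ‖a k‖ ^ 2)
      ≤ 16 * ∑ ε : κ → ℤˣ, ‖∑ k, ((ε k : ℤ) : 𝕜) * a k‖ := by
  have h1 := sqrt_sum_sq_le_sum_signs fun k => RCLike.re (a k)
  have h2 := sqrt_sum_sq_le_sum_signs fun k => RCLike.im (a k)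
  have h3 : √(∑ k, ‖a k‖ ^ 2) ≤ √(∑ k, RCLike.re (a k) ^ 2) + √(∑ k, RCLike.im (a k) ^ 2) := by
    have e : ∑ k, ‖a k‖ ^ 2 = ∑ k, RCLike.re (a k) ^ 2 + ∑ k, RCLike.im (a k) ^ 2 := by
      rw [← Finset.sum_add_distrib]
      refine Finset.sum_congr rfl fun k _ => ?_
      rw [RCLike.norm_sq_eq_def, sq, sq]
    rw [e]
    have hp : 0 ≤ ∑ k, RCLike.re (a k) ^ 2 := Finset.sum_nonneg fun _ _ => sq_nonneg _
    have hq : 0 ≤ ∑ k, RCLike.im (a k) ^ 2 := Finset.sum_nonneg fun _ _ => sq_nonneg _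
    rw [Real.sqrt_le_left (by positivity), add_sq, Real.sq_sqrt hp, Real.sq_sqrt hq]
    have : 0 ≤ √(∑ k, RCLike.re (a k) ^ 2) * √(∑ k, RCLike.im (a k) ^ 2) := by positivity
    linarith
  have hcast : ∀ (u : ℤˣ), ((u : ℤ) : 𝕜) = (((u : ℤ) : ℝ) : 𝕜) := fun u => by push_cast; rfl
  have h4 : ∑ ε : κ → ℤˣ, |∑ k, (ε k : ℤ) * RCLike.re (a k)|
      ≤ ∑ ε : κ → ℤˣ, ‖∑ k, ((ε k : ℤ) : 𝕜) * a k‖ := by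
    refine Finset.sum_le_sum fun ε _ => ?_
    have := RCLike.abs_re_le_norm (∑ k, ((ε k : ℤ) : 𝕜) * a k)
    simpa only [map_sum, hcast, RCLike.re_ofReal_mul] using this
  have h5 : ∑ ε : κ → ℤˣ, |∑ k, (ε k : ℤ) * RCLike.im (a k)|
      ≤ ∑ ε : κ → ℤˣ, ‖∑ k, ((ε k : ℤ) : 𝕜) * a k‖ := by
    refine Finset.sum_le_sum fun ε _ => ?_
    have := RCLike.abs_im_le_norm (∑ k, ((ε k : ℤ) : 𝕜) * a k)
    simpa only [map_sum, hcast, RCLike.im_ofReal_mul] using this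
  calc 2 ^ Fintype.card κ * √(∑ k, ‖a k‖ ^ 2)
      ≤ 2 ^ Fintype.card κ * (√(∑ k, RCLike.re (a k) ^ 2) + √(∑ k, RCLike.im (a k) ^ 2)) := by
        gcongr
    _ ≤ _ := by linarith

variable {E H ι β κ : Type*} [NormedAddCommGroup E] [NormedSpace 𝕜 E]
  [NormedAddCommGroup H] [NormedSpace 𝕜 H]
  {L : SummationFilter ι} [L.NeBot] [L.LeAtTop] {e : GeneralSchauderBasis ι 𝕜 E L}
  {L' : SummationFilter β} [L'.NeBot] [L'.LeAtTop] {f : GeneralSchauderBasis β 𝕜 H L'}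

/-- Coordinatewise, Khintchine's inequality bounds the square function by an average of moduli of
signed sums of the `h k`, each controlled by `M`. The constant is `2 * 16 * 2`, with one factor 2
for each use of `SignInvariant.norm_sum_le`. -/
theorem IsOneUnconditional.norm_square_function_le [Fintype κ] [DecidableEq κ]
    (he : IsOneUnconditional e) (J : Finset ι) (h : κ → E) (M : ℝ)
    (hM : ∀ ε : κ → ℤˣ, ‖∑ k, ε k • h k‖ ≤ M) :
    ‖∑ j ∈ J, ((√(∑ k, ‖e.coord j (h k)‖ ^ 2) : ℝ) : 𝕜) • e j‖ ≤ 64 * M := by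
  set N := (2 : ℝ) ^ Fintype.card κ with hN
  have hN0 : 0 < N := by positivity
  set S : (κ → ℤˣ) → ι → 𝕜 := fun ε j => e.coord j (∑ k, ε k • h k) with hS
  have hSe : ∀ ε j, S ε j = ∑ k, ((ε k : ℤ) : 𝕜) * e.coord j (h k) := by
    intro ε j
    simp only [hS, map_sum, units_smul_eq_smul 𝕜, map_smul, smul_eq_mul]
  have h1 : ‖∑ j ∈ J, ((√(∑ k, ‖e.coord j (h k)‖ ^ 2) : ℝ) : 𝕜) • e j‖
      ≤ 2 * ‖∑ j ∈ J, ((16 / N * ∑ ε, ‖S ε j‖ : ℝ) : 𝕜) • e j‖ := by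
    refine he.signInvariant.norm_sum_le J _ _ fun j _ => ?_
    rw [RCLike.norm_of_nonneg (by positivity), RCLike.norm_of_nonneg (by positivity)]
    have := sqrt_sum_norm_sq_le_sum_signs fun k => e.coord j (h k)
    simp_rw [← hSe] at this
    rw [div_mul_eq_mul_div, le_div_iff₀ hN0]
    linarith
  have h2 : ∑ j ∈ J, ((16 / N * ∑ ε, ‖S ε j‖ : ℝ) : 𝕜) • e j
      = ((16 / N : ℝ) : 𝕜) • ∑ ε, ∑ j ∈ J, ((‖S ε j‖ : ℝ) : 𝕜) • e j := by
    rw [Finset.sum_comm, Finset.smul_sum]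
    refine Finset.sum_congr rfl fun j _ => ?_
    rw [← Finset.sum_smul, smul_smul]
    congr 1
    push_cast
    rfl
  have h3 : ∀ ε, ‖∑ j ∈ J, ((‖S ε j‖ : ℝ) : 𝕜) • e j‖ ≤ 2 * M := by
    intro ε
    refine (he.signInvariant.norm_sum_le J _ (S ε) fun j _ => ?_).trans ?_
    · rw [RCLike.norm_of_nonneg (norm_nonneg _)]
    · have := he.norm_sum_signs_coord_le J (∑ k, ε k • h k) 1
      simp only [Pi.one_apply, one_smul] at this
      linarith [hM ε]
  have h4 : ‖∑ ε, ∑ j ∈ J, ((‖S ε j‖ : ℝ) : 𝕜) • e j‖ ≤ N * (2 * M) := by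
    refine (norm_sum_le _ _).trans ((Finset.sum_le_sum fun ε _ => h3 ε).trans ?_)
    simp [hN]
  rw [h2, norm_smul, RCLike.norm_of_nonneg (by positivity)] at h1
  calc _ ≤ 2 * (16 / N * (N * (2 * M))) := h1.trans (by gcongr)
    _ = 64 * M := by field_simp; ring

/-- The diagonal of an operator composed with sign changes depending on the coordinate is bounded
by a multiple of the norm of the operator. -/
theorem CotypeBound.norm_sum_diagonal_le {r C : ℝ} (hC : CotypeBound H r C) (hC0 : 0 ≤ C)
    (hr : 1 ≤ r) (he : IsOneUnconditional e) (hf : IsOneUnconditional f) (v : E →L[𝕜] H)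
    [Fintype κ] (n : κ → β) (hn : Function.Injective n) (J : Finset ι) (θ : κ → ι → ℤˣ)
    (h : κ → E) (M : ℝ) (hM : ∀ ε : κ → ℤˣ, ‖∑ k, ε k • h k‖ ≤ M) :
    ‖∑ k, f.coord (n k) (v (∑ j ∈ J, θ k j • (e.coord j (h k) • e j))) • f (n k)‖
      ≤ 128 * squareFunctionConst r C * ‖v‖ * M := by
  classical
  have hM0 : 0 ≤ M := (norm_nonneg _).trans (hM 1)
  set N := (2 : ℝ) ^ Fintype.card κ with hN
  have hN0 : 0 < N := by positivity
  set g : κ → E := fun k => ∑ j ∈ J, θ k j • (e.coord j (h k) • e j) with hg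
  -- Orthogonality of the signs removes the off-diagonal terms: the diagonal is an average of
  -- expressions bounded by `‖v (∑ l, ε l • g l)‖`.
  have havg : (N : 𝕜) • ∑ k, f.coord (n k) (v (g k)) • f (n k)
      = ∑ ε : κ → ℤˣ, ∑ k, ε k • (f.coord (n k) (v (∑ l, ε l • g l)) • f (n k)) := by
    rw [Finset.sum_comm, Finset.smul_sum]
    refine Finset.sum_congr rfl fun k _ => ?_
    simp only [units_smul_eq_smul 𝕜, map_sum, map_smul, smul_eq_mul, smul_smul]
    rw [← Finset.sum_smul]
    congr 1
    simp_rw [Finset.mul_sum]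
    rw [Finset.sum_comm]
    have : ∀ l, ∑ ε : κ → ℤˣ, ((ε k : ℤ) : 𝕜) * (((ε l : ℤ) : 𝕜) * f.coord (n k) (v (g l)))
        = if k = l then (N : 𝕜) * f.coord (n k) (v (g l)) else 0 := by
      intro l
      have h0 := congrArg (Int.cast : ℤ → 𝕜) (sum_units_mul_units k l)
      push_cast at h0
      simp_rw [← mul_assoc]
      rw [← Finset.sum_mul, h0]
      split_ifs
      · rw [hN, RCLike.ofReal_pow, RCLike.ofReal_ofNat]
      · simp
    simp_rw [this]
    simp
  have hdiag : ∀ ε : κ → ℤˣ, ‖∑ k, ε k • (f.coord (n k) (v (∑ l, ε l • g l)) • f (n k))‖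
      ≤ ‖v (∑ l, ε l • g l)‖ := by
    intro ε
    have := hf.norm_sum_signs_coord_le (Finset.univ.image n) (v (∑ l, ε l • g l))
      (Function.extend n ε 1)
    rw [Finset.sum_image (fun _ _ _ _ hh => hn hh)] at this
    simpa only [hn.extend_apply] using this
  -- The square function of the `h k` is also that of the `g k`, whatever the signs `θ`; this is why
  -- `θ` may depend on `k`.
  set σ : ι → ℝ := fun j => √(∑ k, ‖e.coord j (h k)‖ ^ 2) with hσ
  have hσ2 : ∀ j, σ j ^ 2 = ∑ k, ‖e.coord j (h k)‖ ^ 2 := fun j =>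
    Real.sq_sqrt (Finset.sum_nonneg fun _ _ => sq_nonneg _)
  have hσ0 : ∀ j k, σ j = 0 → e.coord j (h k) = 0 := by
    intro j k hj
    have h0 := hσ2 j
    rw [hj, zero_pow two_ne_zero, eq_comm,
      Finset.sum_eq_zero_iff_of_nonneg fun _ _ => sq_nonneg _] at h0
    simpa using h0 k (Finset.mem_univ k)
  set a : κ → ι → 𝕜 := fun k j => ((θ k j : ℤ) : 𝕜) * e.coord j (h k) / (σ j : 𝕜) with ha
  have ha1 : ∀ j, ∑ k, ‖a k j‖ ^ 2 ≤ 1 := by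
    intro j
    simp only [ha, norm_div, norm_mul, norm_units_cast, one_mul, RCLike.norm_ofReal, div_pow,
      sq_abs]
    rw [← Finset.sum_div, ← hσ2]
    exact div_self_le_one _
  have hx : ∀ c : ι → 𝕜, (∀ j, ‖c j‖ ≤ 1) →
      ‖∑ j ∈ J, c j • v ((σ j : 𝕜) • e j)‖ ≤ ‖v‖ * (2 * (64 * M)) := by
    intro c hc
    have e1 : ∑ j ∈ J, c j • v ((σ j : 𝕜) • e j) = v (∑ j ∈ J, (c j * (σ j : 𝕜)) • e j) := by
      simp [map_sum, smul_smul]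
    rw [e1]
    refine (v.le_opNorm _).trans ?_
    gcongr
    refine (he.signInvariant.norm_sum_le J _ (fun j => (σ j : 𝕜)) fun j _ => ?_).trans ?_
    · rw [norm_mul]
      exact mul_le_of_le_one_left (norm_nonneg _) (hc j)
    · gcongr
      exact he.norm_square_function_le J h M hM
  have hsq := hC.sum_signs_norm_le hC0 hr J _ hx a ha1
  have hid : ∀ ε : κ → ℤˣ, ∑ j ∈ J, (∑ k, ((ε k : ℤ) : 𝕜) * a k j) • v ((σ j : 𝕜) • e j)
      = v (∑ l, ε l • g l) := by
    intro ε
    simp only [hg, map_sum, units_smul_eq_smul 𝕜, map_smul, Finset.smul_sum, Finset.sum_smul]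
    rw [Finset.sum_comm]
    refine Finset.sum_congr rfl fun k _ => Finset.sum_congr rfl fun j _ => ?_
    simp only [smul_smul]
    congr 1
    by_cases hj : σ j = 0
    · simp [hj, hσ0 j k hj]
    · have : (σ j : 𝕜) ≠ 0 := RCLike.ofReal_ne_zero.2 hj
      simp only [ha]
      field_simp
  simp_rw [hid] at hsq
  have hfin : N * ‖∑ k, f.coord (n k) (v (g k)) • f (n k)‖
      ≤ squareFunctionConst r C * (‖v‖ * (2 * (64 * M))) * N := by
    calc N * ‖∑ k, f.coord (n k) (v (g k)) • f (n k)‖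
        = ‖(N : 𝕜) • ∑ k, f.coord (n k) (v (g k)) • f (n k)‖ := by
          rw [norm_smul, RCLike.norm_of_nonneg hN0.le]
      _ ≤ ∑ ε : κ → ℤˣ, ‖v (∑ l, ε l • g l)‖ := by
          rw [havg]
          exact (norm_sum_le _ _).trans (Finset.sum_le_sum fun ε _ => hdiag ε)
      _ ≤ _ := hsq
  refine le_of_mul_le_mul_left (hfin.trans_eq ?_) hN0
  ring

end Operators

/-! ### Rank one operators on the plane -/

section RankOne

variable {𝕜 ι : Type*} [RCLike 𝕜]

/-- For a rank one matrix the determinant vanishes, so the squared trace is `(α * ξ - β * η) ^ 2 + 4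
* (α * η) * (β * ξ)`. The three terms on the right measure how far the matrix is from preserving the
two axes and the diagonal line. -/
theorem norm_add_le_of_rank_one (α β ξ η : 𝕜) :
    ‖α * ξ + β * η‖ ≤ 2 * ‖α * η‖ + 2 * ‖β * ξ‖ + ‖(α - β) * (ξ + η)‖ := by
  have h1 : ‖α * ξ + β * η‖ ≤ ‖α * ξ - β * η‖ + ‖α * η‖ + ‖β * ξ‖ := by
    have h : ‖α * ξ + β * η‖ ^ 2 ≤ (‖α * ξ - β * η‖ + ‖α * η‖ + ‖β * ξ‖) ^ 2 := by
      calc ‖α * ξ + β * η‖ ^ 2 = ‖(α * ξ - β * η) ^ 2 + 4 * ((α * η) * (β * ξ))‖ := by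
            rw [← norm_pow]; congr 1; ring
        _ ≤ ‖α * ξ - β * η‖ ^ 2 + 4 * (‖α * η‖ * ‖β * ξ‖) := by
            refine (norm_add_le _ _).trans ?_
            rw [norm_pow, norm_mul 4, norm_mul (α * η), RCLike.norm_ofNat]
        _ ≤ _ := by
            nlinarith [sq_nonneg (‖α * η‖ - ‖β * ξ‖), norm_nonneg (α * ξ - β * η),
              norm_nonneg (α * η), norm_nonneg (β * ξ),
              mul_nonneg (norm_nonneg (α * ξ - β * η)) (norm_nonneg (α * η)),
              mul_nonneg (norm_nonneg (α * ξ - β * η)) (norm_nonneg (β * ξ))]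
    exact (sq_le_sq₀ (norm_nonneg _) (by positivity)).1 h
  have h2 : ‖α * ξ - β * η‖ ≤ ‖(α - β) * (ξ + η)‖ + ‖α * η‖ + ‖β * ξ‖ := by
    have : α * ξ - β * η = (α - β) * (ξ + η) - α * η + β * ξ := by ring
    rw [this]
    exact (norm_add_le _ _).trans (add_le_add (norm_sub_le _ _) le_rfl)
  linarith

theorem exists_signs_sum_norm_le (J : Finset ι) (q : ι → 𝕜) :
    ∃ θ : ι → ℤˣ, ∑ j ∈ J, ‖q j‖ ≤ 2 * ‖∑ j ∈ J, ((θ j : ℤ) : 𝕜) * q j‖ := by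
  have key : ∀ y : ι → ℝ, ∃ θ : ι → ℤˣ, ∑ j ∈ J, |y j| = ∑ j ∈ J, (θ j : ℤ) * y j := by
    intro y
    refine ⟨fun j => if 0 ≤ y j then 1 else -1, Finset.sum_congr rfl fun j _ => ?_⟩
    rcases le_or_gt 0 (y j) with h | h
    · simp [h, abs_of_nonneg h]
    · simp [not_le.2 h, abs_of_neg h]
  have hcast : ∀ (u : ℤˣ), ((u : ℤ) : 𝕜) = (((u : ℤ) : ℝ) : 𝕜) := fun u => by push_cast; rfl
  have hle : ∑ j ∈ J, ‖q j‖ ≤ ∑ j ∈ J, |RCLike.re (q j)| + ∑ j ∈ J, |RCLike.im (q j)| := by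
    rw [← Finset.sum_add_distrib]
    refine Finset.sum_le_sum fun j _ => ?_
    refine (sq_le_sq₀ (norm_nonneg _) (by positivity)).1 ?_
    rw [RCLike.norm_sq_eq_def]
    nlinarith [sq_abs (RCLike.re (q j)), sq_abs (RCLike.im (q j)),
      mul_nonneg (abs_nonneg (RCLike.re (q j))) (abs_nonneg (RCLike.im (q j)))]
  rcases le_total (∑ j ∈ J, |RCLike.im (q j)|) (∑ j ∈ J, |RCLike.re (q j)|) with h | h
  · obtain ⟨θ, hθ⟩ := key fun j => RCLike.re (q j)
    refine ⟨θ, ?_⟩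
    have := (le_abs_self _).trans (RCLike.abs_re_le_norm (∑ j ∈ J, ((θ j : ℤ) : 𝕜) * q j))
    simp only [map_sum, hcast, RCLike.re_ofReal_mul] at this ⊢
    linarith
  · obtain ⟨θ, hθ⟩ := key fun j => RCLike.im (q j)
    refine ⟨θ, ?_⟩
    have := (le_abs_self _).trans (RCLike.abs_im_le_norm (∑ j ∈ J, ((θ j : ℤ) : 𝕜) * q j))
    simp only [map_sum, hcast, RCLike.im_ofReal_mul] at this ⊢
    linarith

end RankOne

/-! ### The planes and their unconditional decomposition -/

section Construction

variable {𝕜 : Type*} [RCLike 𝕜]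

/-- The four functionals on the plane which are measured by the norms of the four spaces. -/
noncomputable def planeFunctional (𝕜 : Type*) [RCLike 𝕜] : Fin 4 → (𝕜 × 𝕜 →L[𝕜] 𝕜) :=
  ![ContinuousLinearMap.fst 𝕜 𝕜 𝕜, ContinuousLinearMap.snd 𝕜 𝕜 𝕜,
    ContinuousLinearMap.fst 𝕜 𝕜 𝕜 - ContinuousLinearMap.snd 𝕜 𝕜 𝕜, ContinuousLinearMap.fst 𝕜 𝕜 𝕜]

/-- Vectors spanning the kernels of the first three functionals. -/
def kernelVector (𝕜 : Type*) [RCLike 𝕜] : Fin 3 → 𝕜 × 𝕜 := ![(0, 1), (1, 0), (1, 1)]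

variable {F : Fin 4 → Type*} [∀ i, NormedAddCommGroup (F i)] [∀ i, NormedSpace 𝕜 (F i)]
  (f : ∀ i, SchauderBasis 𝕜 (F i)) (w : Fin 4 → ℕ → ℝ)

/-- The `k`-th plane in the direct sum, parametrised by its coordinates. -/
noncomputable def planeVector (k : ℕ) : 𝕜 × 𝕜 →ₗ[𝕜] ((i : Fin 4) → F i) :=
  LinearMap.pi fun i => ((w i k : 𝕜) • (planeFunctional 𝕜 i : 𝕜 × 𝕜 →ₗ[𝕜] 𝕜)).smulRight (f i k)

theorem planeVector_apply (k : ℕ) (p : 𝕜 × 𝕜) (i : Fin 4) :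
    planeVector f w k p i = ((w i k : 𝕜) * planeFunctional 𝕜 i p) • f i k := rfl

/-- The plane coordinates of a vector of the direct sum, read off from its first two components. -/
noncomputable def planeCoord (k : ℕ) : ((i : Fin 4) → F i) →L[𝕜] 𝕜 × 𝕜 :=
  ((w 0 k : 𝕜)⁻¹ • (((f 0).coord k).comp (ContinuousLinearMap.proj 0))).prod
    ((w 1 k : 𝕜)⁻¹ • (((f 1).coord k).comp (ContinuousLinearMap.proj 1)))

theorem planeCoord_apply (k : ℕ) (z : (i : Fin 4) → F i) :
    planeCoord f w k z
      = ((w 0 k : 𝕜)⁻¹ * (f 0).coord k (z 0), (w 1 k : 𝕜)⁻¹ * (f 1).coord k (z 1)) := rfl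

/-- The closed linear span of the planes. -/
noncomputable def planeSpan : Submodule 𝕜 ((i : Fin 4) → F i) where
  carrier := {z | ∀ k i, (f i).coord k (z i) = w i k * planeFunctional 𝕜 i (planeCoord f w k z)}
  add_mem' := by
    intro x y hx hy k i
    simp only [Set.mem_ofPred_eq] at hx hy
    rw [Pi.add_apply, map_add, hx, hy, map_add, map_add, mul_add]
  zero_mem' := by intro k i; simp
  smul_mem' := by
    intro c x hx k i
    simp only [Set.mem_ofPred_eq] at hx
    rw [Pi.smul_apply, map_smul, hx, map_smul, map_smul, smul_eq_mul, smul_eq_mul, mul_left_comm]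

theorem mem_planeSpan {z : (i : Fin 4) → F i} : z ∈ planeSpan f w ↔
    ∀ k i, (f i).coord k (z i) = w i k * planeFunctional 𝕜 i (planeCoord f w k z) := Iff.rfl

theorem isClosed_planeSpan : IsClosed (planeSpan f w : Set ((i : Fin 4) → F i)) := by
  have : (planeSpan f w : Set ((i : Fin 4) → F i)) = ⋂ k, ⋂ i,
      {z | (f i).coord k (z i) = w i k * planeFunctional 𝕜 i (planeCoord f w k z)} := by
    ext z; simp [mem_planeSpan]
  rw [this]
  refine isClosed_iInter fun k => isClosed_iInter fun i => isClosed_eq ?_ ?_ <;> fun_prop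

variable {f w}

theorem planeCoord_planeVector (hw : ∀ i k, 0 < w i k) (k l : ℕ) (p : 𝕜 × 𝕜) :
    planeCoord f w k (planeVector f w l p) = if k = l then p else 0 := by
  have h0 : (w 0 k : 𝕜) ≠ 0 := RCLike.ofReal_ne_zero.2 (hw 0 k).ne'
  have h1 : (w 1 k : 𝕜) ≠ 0 := RCLike.ofReal_ne_zero.2 (hw 1 k).ne'
  rw [planeCoord_apply]
  simp only [planeVector_apply, map_smul, (f _).ortho, Pi.single_apply]
  split_ifs with h
  · subst h
    ext <;> simp [planeFunctional, h0, h1]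
  · simp

theorem planeVector_mem (hw : ∀ i k, 0 < w i k) (k : ℕ) (p : 𝕜 × 𝕜) :
    planeVector f w k p ∈ planeSpan f w := by
  intro l i
  rw [planeCoord_planeVector hw]
  simp only [planeVector_apply, map_smul, (f _).ortho, Pi.single_apply]
  split_ifs with h
  · subst h; simp
  · simp

/-- The `k`-th plane as a subspace of the closed span of all planes. -/
noncomputable def planeVectorMem (hw : ∀ i k, 0 < w i k) (k : ℕ) : 𝕜 × 𝕜 →ₗ[𝕜] planeSpan f w :=
  (planeVector f w k).codRestrict (planeSpan f w) (planeVector_mem hw k)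

theorem coe_planeVectorMem (hw : ∀ i k, 0 < w i k) (k : ℕ) (p : 𝕜 × 𝕜) :
    (planeVectorMem (f := f) hw k p : (i : Fin 4) → F i) = planeVector f w k p := rfl

/-- The `k`-th plane. -/
noncomputable def plane (f : ∀ i, SchauderBasis 𝕜 (F i)) (hw : ∀ i k, 0 < w i k) (k : ℕ) :
    Submodule 𝕜 (planeSpan f w) :=
  (planeVectorMem hw k).range

theorem planeVectorMem_injective (hw : ∀ i k, 0 < w i k) (k : ℕ) :
    Function.Injective (planeVectorMem (f := f) hw k) := by
  intro p q h
  have := congrArg (fun z : planeSpan f w => planeCoord f w k z) h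
  simpa [coe_planeVectorMem, planeCoord_planeVector hw] using this

theorem planeVectorMem_mem_plane (hw : ∀ i k, 0 < w i k) (k : ℕ) (p : 𝕜 × 𝕜) :
    planeVectorMem hw k p ∈ plane f hw k := LinearMap.mem_range_self _ p

theorem finrank_plane (hw : ∀ i k, 0 < w i k) (k : ℕ) :
    Module.finrank 𝕜 (plane f hw k) = 2 := by
  rw [plane, LinearMap.finrank_range_of_inj (planeVectorMem_injective hw k)]
  simp

theorem norm_sum_signs_planeVector_le (hunc : ∀ i, IsOneUnconditional (f i)) (s : Finset ℕ)
    (p : ℕ → 𝕜 × 𝕜) (ε : ℕ → ℤˣ) :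
    ‖∑ k ∈ s, ε k • planeVector f w k (p k)‖ ≤ ‖∑ k ∈ s, planeVector f w k (p k)‖ := by
  refine (pi_norm_le_iff_of_nonneg (norm_nonneg _)).2 fun i => ?_
  refine le_trans ?_ (norm_le_pi_norm _ i)
  have := (hunc i).signInvariant s (fun k => w i k * planeFunctional 𝕜 i (p k)) ε
  rw [Finset.sum_apply, Finset.sum_apply]
  exact this

theorem norm_sum_signs_planeVectorMem_le (hw : ∀ i k, 0 < w i k)
    (hunc : ∀ i, IsOneUnconditional (f i)) (s : Finset ℕ) (p : ℕ → 𝕜 × 𝕜) (ε : ℕ → ℤˣ) :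
    ‖∑ k ∈ s, ε k • planeVectorMem (f := f) hw k (p k)‖
      ≤ ‖∑ k ∈ s, planeVectorMem (f := f) hw k (p k)‖ := by
  have := norm_sum_signs_planeVector_le (w := w) hunc s p ε
  change ‖((∑ k ∈ s, ε k • planeVectorMem hw k (p k) : planeSpan f w) : (i : Fin 4) → F i)‖
    ≤ ‖((∑ k ∈ s, planeVectorMem hw k (p k) : planeSpan f w) : (i : Fin 4) → F i)‖
  rw [AddSubmonoidClass.coe_finsetSum, AddSubmonoidClass.coe_finsetSum]
  have e : ∀ k, ((ε k • planeVectorMem hw k (p k) : planeSpan f w) : (i : Fin 4) → F i)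
      = ε k • planeVector f w k (p k) := by
    intro k
    rcases Int.units_eq_one_or (ε k) with h | h <;> simp [h, coe_planeVectorMem]
  simp_rw [e]
  exact this

/-- The equations defining `planeSpan` make the basis expansions of the four components fit together
plane by plane. Hence that closed subspace is no larger than the closed span of the planes. -/
theorem tendsto_sum_planeVector {z : (i : Fin 4) → F i} (hz : z ∈ planeSpan f w) :
    Tendsto (fun n => ∑ k ∈ Finset.range n, planeVector f w k (planeCoord f w k z)) atTop
      (𝓝 z) := by
  refine tendsto_pi_nhds.2 fun i => ?_
  refine ((SchauderBasis.tendsto_proj (f i) (z i))).congr fun n => ?_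
  rw [SchauderBasis.proj_apply, Finset.sum_apply]
  refine Finset.sum_congr rfl fun k _ => ?_
  rw [planeVector_apply, ← hz k i]

theorem isUnconditionalDecomposition_plane (hw : ∀ i k, 0 < w i k)
    (hunc : ∀ i, IsOneUnconditional (f i)) : IsUnconditionalDecomposition (plane f hw) := by
  refine ⟨⟨fun k => ?_, fun x => ?_⟩, 1, fun s z ε => ?_⟩
  · have : FiniteDimensional 𝕜 (plane f hw k) := by unfold plane; infer_instance
    exact Submodule.closed_of_finiteDimensional _
  · refine ⟨fun k => ⟨planeVectorMem hw k (planeCoord f w k x), planeVectorMem_mem_plane hw k _⟩,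
      ?_, fun z hz => ?_⟩
    · change Tendsto (fun n => ∑ k ∈ Finset.range n,
        planeVectorMem hw k (planeCoord f w k x)) atTop (𝓝 x)
      rw [tendsto_subtype_rng]
      refine (tendsto_sum_planeVector x.2).congr fun n => ?_
      rw [AddSubmonoidClass.coe_finsetSum]
      rfl
    · funext k
      obtain ⟨p, hp⟩ : ∃ p : ℕ → 𝕜 × 𝕜, ∀ l, planeVectorMem hw l (p l) = (z l : planeSpan f w) :=
        ⟨fun l => (z l).2.choose, fun l => (z l).2.choose_spec⟩
      have h1 : Tendsto (fun n => planeCoord f w k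
          ((∑ l ∈ Finset.range n, (z l : planeSpan f w) : planeSpan f w) : (i : Fin 4) → F i))
          atTop (𝓝 (planeCoord f w k x)) :=
        ((planeCoord f w k).continuous.tendsto _).comp
          ((continuous_subtype_val.tendsto x).comp hz)
      have h2 : ∀ᶠ n in atTop, planeCoord f w k
          ((∑ l ∈ Finset.range n, (z l : planeSpan f w) : planeSpan f w) : (i : Fin 4) → F i)
          = p k := by
        filter_upwards [eventually_gt_atTop k] with n hn
        rw [AddSubmonoidClass.coe_finsetSum, map_sum]
        simp_rw [← hp, coe_planeVectorMem, planeCoord_planeVector hw]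
        simp [hn]
      have h3 : p k = planeCoord f w k x :=
        tendsto_nhds_unique (tendsto_const_nhds.congr' (h2.mono fun _ h => h.symm)) h1
      refine Subtype.ext ?_
      rw [← hp, h3]
  · obtain ⟨p, hp⟩ : ∃ p : ℕ → 𝕜 × 𝕜, ∀ l, planeVectorMem hw l (p l) = (z l : planeSpan f w) :=
      ⟨fun l => (z l).2.choose, fun l => (z l).2.choose_spec⟩
    rw [one_mul]
    simp_rw [← hp]
    exact norm_sum_signs_planeVectorMem_le hw hunc s p ε

end Construction

/-! ### From local unconditional structure to a coloring -/

section Coloring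

variable {𝕜 : Type*} [RCLike 𝕜]
  {F : Fin 4 → Type*} [∀ i, NormedAddCommGroup (F i)] [∀ i, NormedSpace 𝕜 (F i)]
  {f : ∀ i, SchauderBasis 𝕜 (F i)} {w : Fin 4 → ℕ → ℝ}

/-- Operators of rank one on the plane that sum up to an operator of trace at least one can be
given signs so that the signed sum does not preserve the kernel of one of the functionals. -/
theorem exists_signs_kernelVector {ι : Type*} (J : Finset ι) (c : ι → 𝕜 × 𝕜)
    (ξ : ι → 𝕜 × 𝕜 →ₗ[𝕜] 𝕜)
    (h : 1 ≤ ‖∑ j ∈ J, ((c j).1 * ξ j (1, 0) + (c j).2 * ξ j (0, 1))‖) :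
    ∃ (i : Fin 3) (θ : ι → ℤˣ), 1 ≤ 10 * ‖∑ j ∈ J, ((θ j : ℤ) : 𝕜) *
      (planeFunctional 𝕜 i.castSucc (c j) * ξ j (kernelVector 𝕜 i))‖ := by
  set q : Fin 3 → ι → 𝕜 := fun i j =>
    planeFunctional 𝕜 i.castSucc (c j) * ξ j (kernelVector 𝕜 i) with hq
  have hsum : 1 ≤ 2 * ∑ j ∈ J, ‖q 0 j‖ + 2 * ∑ j ∈ J, ‖q 1 j‖ + ∑ j ∈ J, ‖q 2 j‖ := by
    refine h.trans ((norm_sum_le _ _).trans ?_)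
    rw [Finset.mul_sum, Finset.mul_sum, ← Finset.sum_add_distrib, ← Finset.sum_add_distrib]
    refine Finset.sum_le_sum fun j _ => ?_
    have h11 : ξ j (1, 1) = ξ j (1, 0) + ξ j (0, 1) := by rw [← map_add]; simp
    have := norm_add_le_of_rank_one (c j).1 (c j).2 (ξ j (1, 0)) (ξ j (0, 1))
    rw [← h11] at this
    exact this
  -- The weights in `hsum` add up to 5; choosing signs costs another factor 2, which gives the 10.
  obtain ⟨i, hi⟩ : ∃ i, 1 / 5 ≤ ∑ j ∈ J, ‖q i j‖ := by
    by_contra! hcon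
    have h0 := hcon 0
    have h1 := hcon 1
    have h2 := hcon 2
    linarith
  obtain ⟨θ, hθ⟩ := exists_signs_sum_norm_le J (q i)
  exact ⟨i, θ, by linarith⟩

/-- Signs on the intermediate basis, chosen separately for each `k`, send the kernel vector to a
vector whose `i`-th component has a coefficient of size at least `w i k / 10`. The diagonal estimate
bounds all these components together, uniformly in `s`. -/
theorem HasLocalUnconditionalStructure.exists_coloring_finset (hw : ∀ i k, 0 < w i k)
    (hunc : ∀ i, IsOneUnconditional (f i)) {r : ℝ} (hr : 1 ≤ r)
    (hcotype : ∀ i, HasCotype (F i) r)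
    (hlust : HasLocalUnconditionalStructure 𝕜 (planeSpan f w)) :
    ∃ K : ℝ, 0 ≤ K ∧ ∀ s : Finset ℕ, ∃ col : ℕ → Fin 3, ∀ (i : Fin 3) (s' : Finset ℕ), s' ⊆ s →
      (∀ k ∈ s', col k = i) → ∀ t : ℕ → 𝕜,
      ‖∑ k ∈ s', (t k * w i.castSucc k) • f i.castSucc k‖
        ≤ K * ‖∑ k ∈ s', t k • planeVector f w k (kernelVector 𝕜 i)‖ := by
  obtain ⟨C, hC1, hC⟩ := hlust
  choose D hD0 hD using fun i => (hcotype i).exists_bound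
  have hsq : ∀ i, 0 ≤ squareFunctionConst r (D i) := fun i => squareFunctionConst_nonneg (hD0 i)
  refine ⟨∑ i, 20 * (128 * squareFunctionConst r (D i) * C),
    Finset.sum_nonneg fun i _ => by have := hsq i; positivity, fun s => ?_⟩
  have hfin : FiniteDimensional 𝕜 (s.sup (plane f hw) : Submodule 𝕜 (planeSpan f w)) := by
    have : ∀ k, FiniteDimensional 𝕜 (plane f hw k) := fun k => by unfold plane; infer_instance
    infer_instance
  obtain ⟨E, _, _, _, ι, _, e, u₀, w₀, he, hwu, hle⟩ := hC _ hfin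
  -- The extension is only algebraic; norm bounds are used for it only on the span of the planes in
  -- `s`.
  obtain ⟨U, hU⟩ := LinearMap.exists_extend u₀.toLinearMap
  have hU' : ∀ z (hz : z ∈ s.sup (plane f hw)), U z = u₀ ⟨z, hz⟩ := fun z hz =>
    LinearMap.congr_fun hU ⟨z, hz⟩
  have hwU : ∀ z ∈ s.sup (plane f hw), w₀ (U z) = z := by
    intro z hz
    rw [hU' z hz]
    exact DFunLike.congr_fun hwu (⟨z, hz⟩ : (s.sup (plane f hw) : Submodule 𝕜 (planeSpan f w)))
  have hUn : ∀ z ∈ s.sup (plane f hw), ‖U z‖ ≤ ‖u₀‖ * ‖z‖ := by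
    intro z hz
    rw [hU' z hz]
    exact u₀.le_opNorm _
  have hmem : ∀ k ∈ s, ∀ p, planeVectorMem hw k p ∈ s.sup (plane f hw) := fun k hk p =>
    (Finset.le_sup (f := plane f hw) hk) (planeVectorMem_mem_plane hw k p)
  set c : ℕ → ι → 𝕜 × 𝕜 := fun k j => planeCoord f w k (w₀ (e j)) with hc
  set ξ : ℕ → ι → 𝕜 × 𝕜 →ₗ[𝕜] 𝕜 := fun k j =>
    (e.coord j : E →ₗ[𝕜] 𝕜) ∘ₗ U ∘ₗ planeVectorMem hw k with hξ
  -- The full sum over `j` is the trace 2 of the identity of the plane, so finite partial sums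
  -- eventually exceed 1. Since `s` is finite, one `J` serves all its planes.
  have htrace : ∀ k ∈ s, ∀ᶠ J : Finset ι in atTop,
      1 ≤ ‖∑ j ∈ J, ((c k j).1 * ξ k j (1, 0) + (c k j).2 * ξ k j (0, 1))‖ := by
    intro k hk
    set P : E →L[𝕜] 𝕜 × 𝕜 :=
      (planeCoord f w k).comp ((planeSpan f w).subtypeL.comp w₀) with hP
    have hs : ∀ p : 𝕜 × 𝕜, HasSum (fun j => ξ k j p • c k j) p := by
      intro p
      have h1 := (e.expansion (U (planeVectorMem hw k p))).map P P.continuous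
      have h2 : P (U (planeVectorMem hw k p)) = p := by
        change planeCoord f w k (w₀ (U (planeVectorMem hw k p))) = p
        rw [hwU _ (hmem k hk p), coe_planeVectorMem, planeCoord_planeVector hw, if_pos rfl]
      rw [h2] at h1
      have h3 : (P ∘ fun j => e.coord j (U (planeVectorMem hw k p)) • e j)
          = fun j => ξ k j p • c k j := by
        funext j
        rw [Function.comp_apply, map_smul]
        rfl
      rwa [h3] at h1
    have h1 := (hs (1, 0)).map (ContinuousLinearMap.fst 𝕜 𝕜 𝕜) (ContinuousLinearMap.continuous _)
    have h2 := (hs (0, 1)).map (ContinuousLinearMap.snd 𝕜 𝕜 𝕜) (ContinuousLinearMap.continuous _)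
    have h3 : Tendsto (fun J : Finset ι =>
        ‖∑ j ∈ J, ((c k j).1 * ξ k j (1, 0) + (c k j).2 * ξ k j (0, 1))‖) atTop (𝓝 ‖(2 : 𝕜)‖) := by
      have h4 : (1 : 𝕜) + 1 = 2 := by norm_num
      refine Tendsto.norm ?_
      rw [← h4]
      refine Tendsto.congr (fun J => ?_) (h1.add h2)
      refine Finset.sum_congr rfl fun j _ => ?_
      simp [mul_comm]
    refine (h3.eventually (lt_mem_nhds (a := 1) ?_)).mono fun J hJ => hJ.le
    rw [RCLike.norm_ofNat]
    norm_num
  obtain ⟨J, hJ⟩ := ((Filter.eventually_all_finset s).2 htrace).exists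
  have hex : ∀ k, ∃ (i : Fin 3) (θ : ι → ℤˣ), k ∈ s → 1 ≤ 10 * ‖∑ j ∈ J, ((θ j : ℤ) : 𝕜) *
      (planeFunctional 𝕜 i.castSucc (c k j) * ξ k j (kernelVector 𝕜 i))‖ := by
    intro k
    by_cases hk : k ∈ s
    · obtain ⟨i, θ, h⟩ := exists_signs_kernelVector J (c k) (ξ k) (hJ k hk)
      exact ⟨i, θ, fun _ => h⟩
    · exact ⟨0, 1, fun h => absurd h hk⟩
  choose col θ hθ using hex
  refine ⟨col, fun i s' hs' hcol t => ?_⟩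
  set i' := i.castSucc
  set ρ : ℕ → 𝕜 := fun k => ∑ j ∈ J, ((θ k j : ℤ) : 𝕜) *
    (planeFunctional 𝕜 i' (c k j) * ξ k j (kernelVector 𝕜 i)) with hρ
  have hρ1 : ∀ k ∈ s', 1 ≤ 10 * ‖ρ k‖ := by
    intro k hk
    have := hθ k (hs' hk)
    rw [hcol k hk] at this
    exact this
  set T := ‖∑ k ∈ s', t k • planeVector f w k (kernelVector 𝕜 i)‖ with hT
  have hT' : ‖∑ k ∈ s', planeVectorMem (f := f) hw k (t k • kernelVector 𝕜 i)‖ = T := by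
    change ‖((∑ k ∈ s', planeVectorMem hw k (t k • kernelVector 𝕜 i) : planeSpan f w) :
      (i : Fin 4) → F i)‖ = T
    rw [AddSubmonoidClass.coe_finsetSum, hT]
    simp_rw [coe_planeVectorMem, map_smul]
  set v : E →L[𝕜] F i' :=
    (ContinuousLinearMap.proj i').comp ((planeSpan f w).subtypeL.comp w₀) with hv
  have hvn : ‖v‖ ≤ ‖w₀‖ := by
    refine v.opNorm_le_bound (norm_nonneg _) fun x => ?_
    exact (norm_le_pi_norm ((w₀ x : planeSpan f w) : (i : Fin 4) → F i) i').trans (w₀.le_opNorm x)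
  set h : s' → E := fun k => U (planeVectorMem hw k (t k • kernelVector 𝕜 i)) with hh
  have hM : ∀ ε : s' → ℤˣ, ‖∑ k, ε k • h k‖ ≤ ‖u₀‖ * T := by
    intro ε
    set ε' : ℕ → ℤˣ := Function.extend Subtype.val ε 1
    have e1 : ∑ k, ε k • h k
        = U (∑ k ∈ s', ε' k • planeVectorMem hw k (t k • kernelVector 𝕜 i)) := by
      rw [map_sum, ← Finset.sum_coe_sort s']
      refine Finset.sum_congr rfl fun k _ => ?_
      have : ε' k = ε k := Subtype.val_injective.extend_apply _ _ _
      rw [this]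
      simp only [hh, units_smul_eq_smul 𝕜, map_smul]
    rw [e1]
    refine (hUn _ ?_).trans ?_
    · refine Submodule.sum_mem _ fun k hk => ?_
      rw [units_smul_eq_smul 𝕜]
      exact Submodule.smul_mem _ _ (hmem k (hs' hk) _)
    · rw [← hT']
      gcongr
      exact norm_sum_signs_planeVectorMem_le hw hunc s' _ ε'
  have hmain := (hD i').norm_sum_diagonal_le (hD0 i') hr he (hunc i') v (Subtype.val : s' → ℕ)
    Subtype.val_injective J (fun k => θ k) h _ hM
  have hcoef : ∀ k : s', (f i').coord k (v (∑ j ∈ J, θ k j • (e.coord j (h k) • e j)))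
      = t k * w i' k * ρ k := by
    intro k
    simp only [map_sum, units_smul_eq_smul 𝕜, map_smul, smul_eq_mul, hρ, Finset.mul_sum]
    refine Finset.sum_congr rfl fun j _ => ?_
    have h1 : (f i').coord k (v (e j)) = w i' k * planeFunctional 𝕜 i' (c k j) :=
      (w₀ (e j)).2 k i'
    have h2 : e.coord j (h k) = t k * ξ k j (kernelVector 𝕜 i) := by
      simp only [hh, hξ, map_smul, smul_eq_mul]
      rfl
    rw [h1, h2]
    ring
  simp_rw [hcoef] at hmain
  rw [Finset.sum_coe_sort s' (fun k => (t k * w i' k * ρ k) • f i' k)] at hmain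
  -- Since `10 * ‖ρ k‖` is at least 1, the multipliers `ρ k` can be removed.
  have hcontr := (hunc i').signInvariant.norm_sum_le s' (fun k => t k * w i' k)
    (fun k => 10 * (t k * w i' k * ρ k)) fun k hk => by
      rw [norm_mul 10, norm_mul _ (ρ k), RCLike.norm_ofNat]
      nlinarith [hρ1 k hk, norm_nonneg (t k * (w i' k : 𝕜))]
  have h10 : ∑ k ∈ s', (10 * (t k * w i' k * ρ k)) • f i' k
      = (10 : 𝕜) • ∑ k ∈ s', (t k * w i' k * ρ k) • f i' k := by
    rw [Finset.smul_sum]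
    exact Finset.sum_congr rfl fun k _ => (smul_smul _ _ _).symm
  rw [h10, norm_smul, RCLike.norm_ofNat] at hcontr
  have hT0 : 0 ≤ T := norm_nonneg _
  have hK := Finset.single_le_sum (f := fun i => 20 * (128 * squareFunctionConst r (D i) * C))
    (fun i _ => by have := hsq i; positivity) (Finset.mem_univ i')
  have hsqi := hsq i'
  calc _ ≤ 2 * (10 * (128 * squareFunctionConst r (D i') * ‖v‖ * (‖u₀‖ * T))) :=
        hcontr.trans (by gcongr)
    _ ≤ 2 * (10 * (128 * squareFunctionConst r (D i') * ‖w₀‖ * (‖u₀‖ * T))) := by gcongr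
    _ = 20 * (128 * squareFunctionConst r (D i') * (‖u₀‖ * ‖w₀‖)) * T := by ring
    _ ≤ 20 * (128 * squareFunctionConst r (D i') * C) * T := by gcongr
    _ ≤ _ := by gcongr

/-- By compactness, the colorings of finite sets give a coloring of the natural numbers. -/
theorem exists_coloring_of_finset {κ : Type*} [Finite κ]
    {P : κ → Finset ℕ → Prop}
    (h : ∀ s : Finset ℕ, ∃ col : ℕ → κ, ∀ i, ∀ s' ⊆ s, (∀ k ∈ s', col k = i) → P i s') :
    ∃ col : ℕ → κ, ∀ i s', (∀ k ∈ s', col k = i) → P i s' := by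
  choose c hc using fun n : ℕ => h (Finset.range n)
  -- The colors of `k` converge along an ultrafilter because there are finitely many. Its
  -- nonprincipality ensures that the ranges eventually contain any given finite set.
  have hlim : ∀ k, ∃ i, ∀ᶠ n in (hyperfilter ℕ : Filter ℕ), c n k = i := by
    intro k
    obtain ⟨i, hi⟩ := Ultrafilter.eq_pure_of_finite ((hyperfilter ℕ).map fun n => c n k)
    refine ⟨i, ?_⟩
    have : ({i} : Set κ) ∈ (hyperfilter ℕ).map fun n => c n k := by
      rw [hi]; exact Ultrafilter.mem_pure.2 rfl
    exact this
  choose col hcol using hlim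
  refine ⟨col, fun i s' hs' => ?_⟩
  have h1 : ∀ᶠ n in (hyperfilter ℕ : Filter ℕ), ∀ k ∈ s', c n k = col k :=
    (Filter.eventually_all_finset s').2 fun k _ => hcol k
  have h2 : ∀ᶠ n in (hyperfilter ℕ : Filter ℕ), s' ⊆ Finset.range n := by
    refine Filter.Eventually.filter_mono Nat.hyperfilter_le_atTop ?_
    filter_upwards [eventually_gt_atTop (s'.sup id)] with n hn k hk
    exact Finset.mem_range.2 ((Finset.le_sup (f := id) hk).trans_lt hn)
  obtain ⟨n, hn1, hn2⟩ := (h1.and h2).exists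
  exact hc n i s' hn2 fun k hk => (hn1 k hk).trans (hs' k hk)

end Coloring

/-! ### Blocks and sparse sequences -/

section Sequences

variable {𝕜 : Type*} [RCLike 𝕜] {E E' : Type*} [NormedAddCommGroup E] [NormedSpace 𝕜 E]
  [NormedAddCommGroup E'] [NormedSpace 𝕜 E'] {x : ℕ → E} {y : ℕ → E'}

theorem Dominates.exists_nonneg (h : Dominates 𝕜 x y) : ∃ C : ℝ, 0 ≤ C ∧
    ∀ (s : Finset ℕ) (t : ℕ → 𝕜), ‖∑ l ∈ s, t l • y l‖ ≤ C * ‖∑ l ∈ s, t l • x l‖ := by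
  obtain ⟨C, hC⟩ := h
  refine ⟨max C 0, le_max_right _ _, fun s t => (hC s t).trans ?_⟩
  gcongr
  exact le_max_left _ _

theorem sum_map_extend {φ : ℕ → ℕ} (hφ : Function.Injective φ) (s : Finset ℕ) (t : ℕ → 𝕜)
    (z : ℕ → E) :
    ∑ k ∈ s.map ⟨φ, hφ⟩, Function.extend φ t 0 k • z k = ∑ l ∈ s, t l • z (φ l) := by
  rw [Finset.sum_map]
  refine Finset.sum_congr rfl fun l _ => ?_
  rw [Function.Embedding.coeFn_mk, hφ.extend_apply]

/-- Domination passes to the subsequence enumerating `A`, so nonequivalence can only come from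
failure of the reverse domination. -/
theorem Dominates.exists_lt_of_not_seqEquivalent (h : Dominates 𝕜 x y)
    (hne : ∀ φ : ℕ → ℕ, StrictMono φ →
      ¬ SeqEquivalent 𝕜 (fun l => x (φ l)) (fun l => y (φ l)))
    {A : Set ℕ} (hA : A.Infinite) (R : ℝ) :
    ∃ (s : Finset ℕ) (t : ℕ → 𝕜), (∀ k ∈ s, k ∈ A) ∧
      R * ‖∑ k ∈ s, t k • y k‖ < ‖∑ k ∈ s, t k • x k‖ := by
  classical
  set φ : ℕ → ℕ := Nat.nth (· ∈ A)
  have hφ : StrictMono φ := Nat.nth_strictMono hA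
  have hmem : ∀ l, φ l ∈ A := fun l => Nat.nth_mem_of_infinite hA l
  by_contra! hcon
  refine hne φ hφ ⟨?_, R, fun s t => ?_⟩
  · obtain ⟨C, hC⟩ := h
    refine ⟨C, fun s t => ?_⟩
    have := hC (s.map ⟨φ, hφ.injective⟩) (Function.extend φ t 0)
    rwa [sum_map_extend, sum_map_extend] at this
  · have := hcon (s.map ⟨φ, hφ.injective⟩) (Function.extend φ t 0) fun k hk => by
      obtain ⟨l, _, rfl⟩ := Finset.mem_map.1 hk
      exact hmem l
    rwa [sum_map_extend, sum_map_extend] at this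

/-- The integers can be grouped into blocks carrying prescribed strict inequalities. -/
theorem Dominates.exists_blocks (h : Dominates 𝕜 x y)
    (hne : ∀ φ : ℕ → ℕ, StrictMono φ →
      ¬ SeqEquivalent 𝕜 (fun l => x (φ l)) (fun l => y (φ l))) (R : ℕ → ℝ) :
    ∃ b : ℕ → ℕ, ∀ q, ∃ (s : Finset ℕ) (t : ℕ → 𝕜), (∀ k ∈ s, b k = q) ∧
      R q * ‖∑ k ∈ s, t k • y k‖ < ‖∑ k ∈ s, t k • x k‖ := by
  have hstep : ∀ q a : ℕ, ∃ a', a < a' ∧ ∃ (s : Finset ℕ) (t : ℕ → 𝕜),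
      (∀ k ∈ s, a ≤ k ∧ k < a') ∧ R q * ‖∑ k ∈ s, t k • y k‖ < ‖∑ k ∈ s, t k • x k‖ := by
    intro q a
    obtain ⟨s, t, hs, hlt⟩ := h.exists_lt_of_not_seqEquivalent hne (Set.Ici_infinite a) (R q)
    refine ⟨a + s.sup id + 1, by omega, s, t, fun k hk => ⟨hs k hk, ?_⟩, hlt⟩
    have : k ≤ s.sup id := Finset.le_sup (f := id) hk
    omega
  choose next hnext s t hs hlt using hstep
  set a : ℕ → ℕ := fun n => Nat.rec 0 (fun q a => next q a) n
  have ha : ∀ q, a (q + 1) = next q (a q) := fun q => rfl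
  have hmono : StrictMono a := strictMono_nat_of_lt_succ fun q => by rw [ha]; exact hnext _ _
  have huniq : ∀ k q q', a q ≤ k → k < a (q + 1) → a q' ≤ k → k < a (q' + 1) → q = q' := by
    intro k q q' h1 h2 h3 h4
    have h5 : q < q' + 1 := hmono.lt_iff_lt.1 (h1.trans_lt h4)
    have h6 : q' < q + 1 := hmono.lt_iff_lt.1 (h3.trans_lt h2)
    omega
  -- The value 0 outside the blocks is a harmless default: only integers in the chosen supports need
  -- the right label.
  have hb : ∀ k, ∃ q, ∀ q', a q' ≤ k → k < a (q' + 1) → q = q' := by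
    intro k
    by_cases hk : ∃ q, a q ≤ k ∧ k < a (q + 1)
    · obtain ⟨q, h1, h2⟩ := hk
      exact ⟨q, fun q' h3 h4 => huniq k q q' h1 h2 h3 h4⟩
    · exact ⟨0, fun q' h3 h4 => absurd ⟨q', h3, h4⟩ hk⟩
  choose b hb using hb
  refine ⟨b, fun q => ⟨s q (a q), t q (a q), fun k hk => ?_, hlt q (a q)⟩⟩
  exact hb k q (hs q (a q) k hk).1 (hs q (a q) k hk).2

theorem sum_half_pow_le_one (s : Finset ℕ) (g : ℕ → ℕ) (hg : Set.InjOn g s) :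
    ∑ k ∈ s, (1 / 2 : ℝ) ^ (g k + 1) ≤ 1 := by
  classical
  rw [← Finset.sum_image (f := fun q => (1 / 2 : ℝ) ^ (q + 1)) hg]
  have h : HasSum (fun q : ℕ => (1 / 2 : ℝ) ^ (q + 1)) 1 := by
    have := hasSum_geometric_two.mul_left (1 / 2 : ℝ)
    norm_num at this
    refine this.congr_fun fun q => ?_
    rw [pow_succ]; ring
  exact sum_le_hasSum _ (fun q _ => by positivity) h

/-- Along indices with distinct exponents the geometric weights have sum at most 1, so the weighted
normalized sequence is dominated by the sup norm of the coefficients. It is used to make a component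
negligible. -/
theorem norm_sum_smul_le_of_injOn (hx : ∀ k, ‖x k‖ = 1) (s : Finset ℕ) (t : ℕ → 𝕜) (g : ℕ → ℕ)
    (hg : Set.InjOn g s) (B : ℝ) (ht : ∀ k ∈ s, ‖t k‖ ≤ B) (hB : 0 ≤ B) :
    ‖∑ k ∈ s, (t k * (((1 / 2 : ℝ) ^ (g k + 1) : ℝ) : 𝕜)) • x k‖ ≤ B := by
  refine (norm_sum_le _ _).trans ?_
  calc ∑ k ∈ s, ‖(t k * (((1 / 2 : ℝ) ^ (g k + 1) : ℝ) : 𝕜)) • x k‖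
      ≤ ∑ k ∈ s, B * (1 / 2 : ℝ) ^ (g k + 1) := by
        refine Finset.sum_le_sum fun k hk => ?_
        rw [norm_smul, hx, mul_one, norm_mul, RCLike.norm_of_nonneg (by positivity)]
        gcongr
        exact ht k hk
    _ ≤ B * 1 := by
        rw [← Finset.mul_sum]
        gcongr
        exact sum_half_pow_le_one s g hg
    _ = B := mul_one B

end Sequences

/-! ### The weights and the contradiction -/

section Construction

variable {𝕜 : Type*} [RCLike 𝕜]
  {F : Fin 4 → Type*} [∀ i, NormedAddCommGroup (F i)] [∀ i, NormedSpace 𝕜 (F i)]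
  {f : ∀ i, SchauderBasis 𝕜 (F i)}

theorem norm_sum_planeVector_le {w : Fin 4 → ℕ → ℝ} (s : Finset ℕ) (t : ℕ → 𝕜) (p : 𝕜 × 𝕜)
    (B : ℝ)
    (h0 : ‖p.1 • ∑ k ∈ s, (t k * w 0 k) • f 0 k‖ ≤ B)
    (h1 : ‖p.2 • ∑ k ∈ s, (t k * w 1 k) • f 1 k‖ ≤ B)
    (h2 : ‖(p.1 - p.2) • ∑ k ∈ s, (t k * w 2 k) • f 2 k‖ ≤ B)
    (h3 : ‖p.1 • ∑ k ∈ s, (t k * w 3 k) • f 3 k‖ ≤ B) :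
    ‖∑ k ∈ s, t k • planeVector f w k p‖ ≤ B := by
  have key : ∀ i, (∑ k ∈ s, t k • planeVector f w k p) i
      = planeFunctional 𝕜 i p • ∑ k ∈ s, (t k * w i k) • f i k := by
    intro i
    rw [Finset.sum_apply, Finset.smul_sum]
    refine Finset.sum_congr rfl fun k _ => ?_
    rw [Pi.smul_apply, planeVector_apply, smul_smul, smul_smul]
    congr 1
    ring
  refine (pi_norm_le_iff_of_nonneg ((norm_nonneg _).trans h0)).2 fun i => ?_
  rw [key]
  match i with
  | 0 => exact h0
  | 1 => exact h1
  | 2 => exact h2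
  | 3 => exact h3

/-- The weights of the planes, for a grouping `b` of the integers into blocks indexed by pairs. -/
noncomputable def blockWeight (b : ℕ → ℕ) : Fin 4 → ℕ → ℝ :=
  ![fun k => (1 / 2) ^ (b k + 1), fun k => (1 / 2) ^ ((Nat.unpair (b k)).1 + 1), fun _ => 1,
    fun _ => 1]

theorem blockWeight_pos (b : ℕ → ℕ) (i : Fin 4) (k : ℕ) : 0 < blockWeight b i k := by
  match i with
  | 0 => exact pow_pos (by norm_num) _
  | 1 => exact pow_pos (by norm_num) _
  | 2 => exact one_pos
  | 3 => exact one_pos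

/-- One integer of color 1 or 2 is selected from each block `(m, p)` with `p ≥ Q`, and such blocks
have index at least `Q`. Infinitely many selections of color 1 in one row `m` give the first case;
otherwise each row contains one of color 2. -/
theorem exists_infinite_of_coloring (b : ℕ → ℕ) (col : ℕ → Fin 3) (Q : ℕ)
    (h0 : ∀ q, Q ≤ q → ∃ k, b k = q ∧ col k ≠ 0) :
    (∃ m, ∃ A : Set ℕ, A.Infinite ∧ Set.InjOn b A ∧
      ∀ k ∈ A, col k = 1 ∧ (Nat.unpair (b k)).1 = m) ∨
    ∃ A : Set ℕ, A.Infinite ∧ Set.InjOn (fun k => (Nat.unpair (b k)).1) A ∧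
      ∀ k ∈ A, col k = 2 := by
  have h0' : ∀ q, ∃ k, Q ≤ q → b k = q ∧ col k ≠ 0 := by
    intro q
    by_cases hq : Q ≤ q
    · obtain ⟨k, hk⟩ := h0 q hq
      exact ⟨k, fun _ => hk⟩
    · exact ⟨0, fun h => absurd h hq⟩
  choose κ hκ using h0'
  have hQ : ∀ m p, Q ≤ p → Q ≤ Nat.pair m p := fun m p hp => hp.trans (Nat.right_le_pair m p)
  by_cases hm : ∃ m, {p | Q ≤ p ∧ col (κ (Nat.pair m p)) = 1}.Infinite
  · left
    obtain ⟨m, hm⟩ := hm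
    refine ⟨m, (fun p => κ (Nat.pair m p)) '' {p | Q ≤ p ∧ col (κ (Nat.pair m p)) = 1},
      hm.image ?_, ?_, ?_⟩
    · intro p hp p' hp' h
      have h1 := (hκ _ (hQ m p hp.1)).1
      have h2 := (hκ _ (hQ m p' hp'.1)).1
      simp only at h
      rw [h, h2, Nat.pair_eq_pair] at h1
      exact h1.2.symm
    · rintro _ ⟨p, hp, rfl⟩ _ ⟨p', hp', rfl⟩ h
      simp only at h ⊢
      rw [(hκ _ (hQ m p hp.1)).1, (hκ _ (hQ m p' hp'.1)).1] at h
      rw [h]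
    · rintro _ ⟨p, hp, rfl⟩
      refine ⟨hp.2, ?_⟩
      simp only
      rw [(hκ _ (hQ m p hp.1)).1, Nat.unpair_pair]
  · right
    push Not at hm
    have hp : ∀ m, ∃ p, Q ≤ p ∧ col (κ (Nat.pair m p)) = 2 := by
      intro m
      obtain ⟨p, hp, hp'⟩ := (Set.Ici_infinite Q).exists_notMem_finite (hm m)
      refine ⟨p, hp, ?_⟩
      have h1 : col (κ (Nat.pair m p)) ≠ 1 := fun h => hp' ⟨hp, h⟩
      have h2 := (hκ _ (hQ m p hp)).2
      revert h1 h2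
      generalize col (κ (Nat.pair m p)) = c
      revert c
      decide
    choose p hp using hp
    have hb : ∀ m, (Nat.unpair (b (κ (Nat.pair m (p m))))).1 = m := fun m => by
      rw [(hκ _ (hQ m (p m) (hp m).1)).1, Nat.unpair_pair]
    refine ⟨Set.range fun m => κ (Nat.pair m (p m)), Set.infinite_range_of_injective ?_, ?_, ?_⟩
    · intro m m' h
      have := congrArg (fun k => (Nat.unpair (b k)).1) h
      simpa only [hb] using this
    · rintro _ ⟨m, rfl⟩ _ ⟨m', rfl⟩ h
      simp only [hb] at h
      rw [h]
    · rintro _ ⟨m, rfl⟩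
      exact (hp m).2

theorem not_exists_coloring (hnorm : ∀ i l, ‖f i l‖ = 1) (hunc : ∀ i, IsOneUnconditional (f i))
    (h12 : Dominates 𝕜 (f 1) (f 2)) (h23 : Dominates 𝕜 (f 2) (f 3))
    (hneq12 : ∀ φ : ℕ → ℕ, StrictMono φ →
      ¬ SeqEquivalent 𝕜 (fun l => f 1 (φ l)) (fun l => f 2 (φ l)))
    (hneq23 : ∀ φ : ℕ → ℕ, StrictMono φ →
      ¬ SeqEquivalent 𝕜 (fun l => f 2 (φ l)) (fun l => f 3 (φ l)))
    (b : ℕ → ℕ) (hb : ∀ q, ∃ (s : Finset ℕ) (t : ℕ → 𝕜), (∀ k ∈ s, b k = q) ∧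
      (q * 2 ^ (q + 1)) * ‖∑ k ∈ s, t k • f 1 k‖ < ‖∑ k ∈ s, t k • f 0 k‖)
    (K : ℝ) (hK : 0 ≤ K) (col : ℕ → Fin 3)
    (hcol : ∀ (i : Fin 3) (s : Finset ℕ), (∀ k ∈ s, col k = i) → ∀ t : ℕ → 𝕜,
      ‖∑ k ∈ s, (t k * blockWeight b i.castSucc k) • f i.castSucc k‖
        ≤ K * ‖∑ k ∈ s, t k • planeVector f (blockWeight b) k (kernelVector 𝕜 i)‖) : False := by
  obtain ⟨D₁, hD₁0, hD₁⟩ := h12.exists_nonneg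
  obtain ⟨D₂, hD₂0, hD₂⟩ := h23.exists_nonneg
  have hw2 : ∀ (s : Finset ℕ) (t : ℕ → 𝕜),
      ∑ k ∈ s, (t k * blockWeight b 2 k) • f 2 k = ∑ k ∈ s, t k • f 2 k := fun s t =>
    Finset.sum_congr rfl fun k _ => by simp [blockWeight]
  have hw3 : ∀ (s : Finset ℕ) (t : ℕ → 𝕜),
      ∑ k ∈ s, (t k * blockWeight b 3 k) • f 3 k = ∑ k ∈ s, t k • f 3 k := fun s t =>
    Finset.sum_congr rfl fun k _ => by simp [blockWeight]
  -- The vector `(0, 1)` leaves only the components 1 and 2, both controlled by `f 1`. If block `q`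
  -- had only color 0, then `f 0` with weight `2 ^ -(q + 1)` would be controlled by `f 1`, against
  -- the choice of the block for large `q`.
  have hblock : ∀ q, ⌈K * (2 + D₁)⌉₊ ≤ q → ∃ k, b k = q ∧ col k ≠ 0 := by
    intro q hq
    obtain ⟨s, t, hs, hlt⟩ := hb q
    by_contra! hcon
    have h1 := hcol 0 s (fun k hk => hcon k (hs k hk)) t
    set T := ‖∑ k ∈ s, t k • f 1 k‖ with hT
    have hT0 : 0 ≤ T := norm_nonneg _
    have h2 : ∑ k ∈ s, (t k * blockWeight b 0 k) • f 0 k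
        = (((1 / 2 : ℝ) ^ (q + 1) : ℝ) : 𝕜) • ∑ k ∈ s, t k • f 0 k := by
      rw [Finset.smul_sum]
      refine Finset.sum_congr rfl fun k hk => ?_
      rw [smul_smul, mul_comm, ← hs k hk]
      rfl
    have h3 : ‖∑ k ∈ s, (t k * blockWeight b 1 k) • f 1 k‖ ≤ 2 * T := by
      refine (hunc 1).signInvariant.norm_sum_le s _ t fun k _ => ?_
      rw [norm_mul, RCLike.norm_of_nonneg (blockWeight_pos b 1 k).le]
      exact mul_le_of_le_one_right (norm_nonneg _) (pow_le_one₀ (by norm_num) (by norm_num))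
    have h4 : ‖∑ k ∈ s, t k • planeVector f (blockWeight b) k (kernelVector 𝕜 0)‖
        ≤ (2 + D₁) * T := by
      have hDT : 0 ≤ D₁ * T := by positivity
      refine norm_sum_planeVector_le s t _ _ ?_ ?_ ?_ ?_
      · simp only [kernelVector, Matrix.cons_val_zero, zero_smul, norm_zero]
        positivity
      · simp only [kernelVector, Matrix.cons_val_zero, one_smul]
        linarith
      · simp only [kernelVector, Matrix.cons_val_zero, hw2, zero_sub, norm_smul, norm_neg, norm_one,
          one_mul]
        linarith [hD₁ s t]
      · simp only [kernelVector, Matrix.cons_val_zero, zero_smul, norm_zero]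
        positivity
    have h5 : ‖∑ k ∈ s, (t k * blockWeight b 0 k) • f 0 k‖ ≤ K * ((2 + D₁) * T) :=
      h1.trans (by gcongr)
    rw [h2, norm_smul, RCLike.norm_of_nonneg (by positivity)] at h5
    have h6 : (q : ℝ) * T < (1 / 2 : ℝ) ^ (q + 1) * ‖∑ k ∈ s, t k • f 0 k‖ := by
      calc (q : ℝ) * T = (1 / 2 : ℝ) ^ (q + 1) * ((q * 2 ^ (q + 1)) * T) := by
            rw [one_div, inv_pow]; field_simp
        _ < _ := by gcongr
    have h7 : K * (2 + D₁) ≤ q := Nat.ceil_le.1 hq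
    have h8 : K * (2 + D₁) * T ≤ q * T := by gcongr
    linarith
  rcases exists_infinite_of_coloring b col _ hblock with ⟨m, A, hA, hinj, hAcol⟩ |
    ⟨A, hA, hinj, hAcol⟩
  · obtain ⟨s, t, hs, hlt⟩ := h12.exists_lt_of_not_seqEquivalent hneq12 hA
      (2 ^ (m + 1) * (K * (1 + D₂)))
    have h1 := hcol 1 s (fun k hk => (hAcol k (hs k hk)).1) t
    set T := ‖∑ k ∈ s, t k • f 2 k‖ with hT
    have hT0 : 0 ≤ T := norm_nonneg _
    have h2 : ∑ k ∈ s, (t k * blockWeight b 1 k) • f 1 k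
        = (((1 / 2 : ℝ) ^ (m + 1) : ℝ) : 𝕜) • ∑ k ∈ s, t k • f 1 k := by
      rw [Finset.smul_sum]
      refine Finset.sum_congr rfl fun k hk => ?_
      rw [smul_smul, mul_comm, ← (hAcol k (hs k hk)).2]
      rfl
    have h3 : ‖∑ k ∈ s, (t k * blockWeight b 0 k) • f 0 k‖ ≤ T :=
      norm_sum_smul_le_of_injOn (hnorm 0) s t b (hinj.mono fun k hk => hs k hk) T
        (fun k hk => (hunc 2).norm_le_sum (hnorm 2) s t hk) hT0
    have h4 : ‖∑ k ∈ s, t k • planeVector f (blockWeight b) k (kernelVector 𝕜 1)‖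
        ≤ (1 + D₂) * T := by
      have hDT : 0 ≤ D₂ * T := by positivity
      refine norm_sum_planeVector_le s t _ _ ?_ ?_ ?_ ?_
      · simp only [kernelVector, Matrix.cons_val_one, Matrix.cons_val_zero, one_smul]
        linarith
      · simp only [kernelVector, Matrix.cons_val_one, Matrix.cons_val_zero, zero_smul, norm_zero]
        positivity
      · simp only [kernelVector, Matrix.cons_val_one, Matrix.cons_val_zero, hw2, sub_zero, one_smul]
        linarith
      · simp only [kernelVector, Matrix.cons_val_one, Matrix.cons_val_zero, hw3, one_smul]
        linarith [hD₂ s t]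
    have h5 : ‖∑ k ∈ s, (t k * blockWeight b 1 k) • f 1 k‖ ≤ K * ((1 + D₂) * T) :=
      h1.trans (by gcongr)
    rw [h2, norm_smul, RCLike.norm_of_nonneg (by positivity)] at h5
    have h6 : K * (1 + D₂) * T < (1 / 2 : ℝ) ^ (m + 1) * ‖∑ k ∈ s, t k • f 1 k‖ := by
      calc K * (1 + D₂) * T = (1 / 2 : ℝ) ^ (m + 1) * (2 ^ (m + 1) * (K * (1 + D₂)) * T) := by
            rw [one_div, inv_pow]; field_simp
        _ < _ := by gcongr
    linarith
  -- Across distinct rows both decaying weights are summable. For `(1, 1)` the component 2 vanishes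
  -- and components 0 and 1 are negligible, so `f 3` would dominate `f 2` on `A`.
  · obtain ⟨s, t, hs, hlt⟩ := h23.exists_lt_of_not_seqEquivalent hneq23 hA K
    have h1 : ‖∑ k ∈ s, (t k * blockWeight b 2 k) • f 2 k‖
        ≤ K * ‖∑ k ∈ s, t k • planeVector f (blockWeight b) k (kernelVector 𝕜 2)‖ :=
      hcol 2 s (fun k hk => hAcol k (hs k hk)) t
    set T := ‖∑ k ∈ s, t k • f 3 k‖ with hT
    have hT0 : 0 ≤ T := norm_nonneg _
    have hinj' : Set.InjOn (fun k => (Nat.unpair (b k)).1) s := hinj.mono fun k hk => hs k hk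
    have hinjb : Set.InjOn b s := fun k hk l hl h => hinj' hk hl (by simp only [h])
    have ht : ∀ k ∈ s, ‖t k‖ ≤ T := fun k hk => (hunc 3).norm_le_sum (hnorm 3) s t hk
    have h4 : ‖∑ k ∈ s, t k • planeVector f (blockWeight b) k (kernelVector 𝕜 2)‖ ≤ T := by
      refine norm_sum_planeVector_le s t _ _ ?_ ?_ ?_ ?_
      · simp only [kernelVector, Matrix.cons_val, one_smul]
        exact norm_sum_smul_le_of_injOn (hnorm 0) s t b hinjb T ht hT0
      · simp only [kernelVector, Matrix.cons_val, one_smul]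
        exact norm_sum_smul_le_of_injOn (hnorm 1) s t _ hinj' T ht hT0
      · simp only [kernelVector, Matrix.cons_val, sub_self, zero_smul, norm_zero]
        exact hT0
      · simp only [kernelVector, Matrix.cons_val, hw3, one_smul]
        exact le_rfl
    rw [hw2] at h1
    have h5 : K * ‖∑ k ∈ s, t k • planeVector f (blockWeight b) k (kernelVector 𝕜 2)‖ ≤ K * T := by
      gcongr
    linarith

end Construction

/-- The direct sum `F₁ ⊕ ⋯ ⊕ F₄` is the product `(i : Fin 4) → F i`, whose norm (the maximum of the
four norms) is equivalent to any other usual norm on the sum. -/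
theorem corollary4p3 {𝕜 : Type*} [RCLike 𝕜] (F : Fin 4 → Type*)
    [∀ i, NormedAddCommGroup (F i)] [∀ i, NormedSpace 𝕜 (F i)] [∀ i, CompleteSpace (F i)]
    (r : ℝ) (hr : 2 ≤ r) (hcotype : ∀ i, HasCotype (F i) r)
    (f : ∀ i, SchauderBasis 𝕜 (F i))
    (hnorm : ∀ i l, ‖f i l‖ = 1)
    (hunc : ∀ i, IsOneUnconditional (f i))
    (hdom : ∀ i : Fin 3, Dominates 𝕜 (f i.castSucc) (f i.succ))
    (hneq : ∀ (i : Fin 3) (φ : ℕ → ℕ), StrictMono φ →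
      ¬ SeqEquivalent 𝕜 (fun l => f i.castSucc (φ l)) (fun l => f i.succ (φ l))) :
    ∃ Y : Submodule 𝕜 ((i : Fin 4) → F i), IsClosed (Y : Set ((i : Fin 4) → F i)) ∧
      ¬ HasLocalUnconditionalStructure 𝕜 Y ∧
      ∃ Z : ℕ → Submodule 𝕜 Y,
        (∀ k, Module.finrank 𝕜 (Z k) = 2) ∧ IsUnconditionalDecomposition Z := by
  have h01 : Dominates 𝕜 (f 0) (f 1) := hdom 0
  -- The factor `2 ^ (q + 1)` compensates the weight of `f 0` on block `q`; the remaining factor `q`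
  -- exceeds any constant.
  obtain ⟨b, hb⟩ := h01.exists_blocks (hneq 0) fun q => q * 2 ^ (q + 1)
  have hw := blockWeight_pos b
  refine ⟨planeSpan f (blockWeight b), isClosed_planeSpan f _, fun hlust => ?_, plane f hw,
    finrank_plane hw, isUnconditionalDecomposition_plane hw hunc⟩
  obtain ⟨K, hK, hcol⟩ := hlust.exists_coloring_finset hw hunc (by linarith) hcotype
  obtain ⟨col, hcol⟩ := exists_coloring_of_finset hcol
  exact not_exists_coloring hnorm hunc (hdom 1) (hdom 2) (hneq 1) (hneq 2) b hb K hK col hcol
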